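/- Let $d\ge 3$. A $d$-dimensional Dantzig figure is a triple $(P,x,y)$ where $P\subset\mathbb R^d$ is a simple $d$-dimensional convex polytope with exactly $2d$ facets and $x,y$ are vertices of $P$ such that half of the facets contain $x$ and the others contain $y$. Two Dantzig figures have the same combinatorial type if there is an isomorphism of their face posets carrying the first (resp. second) distinguished vertex to the first (resp. second) distinguished vertex. A \emph{move} of a facet hyperplane is a family of $d$-polytopes $P(t)$, $0\le t\le 1$, whose facets are cut out, one each, by hyperplanes $\pi_j$ ($j\ne i$), which are fixed, and one hyperplane $\pi_i(t)$ depending continuously on $t$, with $P(t)\subseteq P(s)$ for $t>s$. It is a \emph{fundamental deformation} if $P(t)$ is simple except for exactly one $t=t_0<1$, and there is exactly one vertex $v$ of $P(0)$ that is an intersection of some $\pi_j$ with $j\neq i$ and through which the moving hyperplane passes, where $v\in\pi_i(t_0)$ and $v\notin P(t)$ for $t>t_0$. A fundamental deformation of a Dantzig figure $(P(0),x,y)$ is one in which no edge of $P(0)$ that vanishes (i.e. whose corresponding intersection of facets is empty in $P(1)$) contains $x$ or $y$; it leads to the Dantzig figure $(P(1),x',y')$ where $x'$ and $y'$ lie on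 the facets with the same labels as $x$ and $y$. The moduli-graph $D(d)$ is the directed graph whose vertices are the combinatorial types of $d$-dimensional Dantzig figures, with an arrow from the type of $D$ to the type of $D'$ whenever $D'$ is a fundamental deformation of $D$. Proposition. $D(d)$ is strongly connected: for any two combinatorial types there is a directed (possibly trivial) path in $D(d)$ from the first to the second. Moreover, for any two $d$-dimensional Dantzig figures $D_1,D_2$ there are Dantzig figures $D_1',D_2'$ of the same combinatorial types as $D_1,D_2$ respectively, such that $D_1'$ can be carried to $D_2'$ by a finite sequence of steps, each of which is a fundamental deformation of Dantzig figures or a move of one facet hyperplane (with $x,y$ carried along as above) during which $P(t)$ is simple for all $t$, so that the combinatorial type does not change. -/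

import Mathlib

namespace Dantzig

/-- The Euclidean space `ℝ^d` in which all polytopes live. -/
abbrev E (d : ℕ) : Type := EuclideanSpace ℝ (Fin d)

variable {d : ℕ}

/-- The hyperplane `⟨a, z⟩ = b`. -/
def hyperplane (a : E d) (b : ℝ) : Set (E d) := {z | inner ℝ a z = b}

/-- The intersection of the finitely many closed half-spaces `⟨a j, z⟩ ≤ b j`. -/
def polyhedron {n : ℕ} (a : Fin n → E d) (b : Fin n → ℝ) : Set (E d) :=
  {z | ∀ j, inner ℝ (a j) z ≤ b j}

/-- A `d`-dimensional convex polytope in `ℝ^d`: a bounded intersection of finitely many closed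
half-spaces, with non-empty interior. -/
def IsPolytope (P : Set (E d)) : Prop :=
  (∃ (n : ℕ) (a : Fin n → E d) (b : Fin n → ℝ), P = polyhedron a b) ∧
    Bornology.IsBounded P ∧ (interior P).Nonempty

/-- Faces (including the empty face and `P` itself). -/
def IsFace (P F : Set (E d)) : Prop := IsExposed ℝ P F

/-- Edges: faces of dimension one. -/
def IsEdge (P F : Set (E d)) : Prop :=
  IsFace P F ∧ F.Nonempty ∧ Module.finrank ℝ (vectorSpan ℝ F) = 1

/-- Facets: faces of dimension `d - 1`. -/
def IsFacet (P F : Set (E d)) : Prop :=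
  IsFace P F ∧ F.Nonempty ∧ Module.finrank ℝ (vectorSpan ℝ F) + 1 = d

/-- A simple `d`-polytope: every vertex lies on exactly `d` facets. -/
def IsSimple (P : Set (E d)) : Prop :=
  IsPolytope P ∧ ∀ v ∈ P.extremePoints ℝ, {F | IsFacet P F ∧ v ∈ F}.ncard = d

/-- A `d`-dimensional Dantzig figure `(P, x, y)`: a simple `d`-polytope `P` with exactly `2d`
facets and two vertices `x`, `y`, such that half of the facets contain `x` and the others
contain `y`. -/
structure Figure (d : ℕ) where
  /-- the polytope -/
  P : Set (E d)
  /-- the first distinguished vertex -/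
  x : E d
  /-- the second distinguished vertex -/
  y : E d
  simple : IsSimple P
  x_vertex : x ∈ P.extremePoints ℝ
  y_vertex : y ∈ P.extremePoints ℝ
  card_facets : {F | IsFacet P F}.ncard = 2 * d
  card_facets_x : {F | IsFacet P F ∧ x ∈ F}.ncard = d
  facet_y : ∀ F, IsFacet P F → (x ∉ F ↔ y ∈ F)

/-- The poset of all faces of `P`, ordered by inclusion. -/
abbrev FacePoset (P : Set (E d)) : Type := {F : Set (E d) // IsFace P F}

/-- Two Dantzig figures have the same combinatorial type: there is an isomorphism of face posets
that carries the faces through `x` (resp. `y`) exactly to the faces through the corresponding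
distinguished vertex. -/
def SameType (D D' : Figure d) : Prop :=
  ∃ φ : FacePoset D.P ≃o FacePoset D'.P,
    ∀ F : FacePoset D.P,
      (D.x ∈ (F : Set (E d)) ↔ D'.x ∈ (φ F : Set (E d))) ∧
      (D.y ∈ (F : Set (E d)) ↔ D'.y ∈ (φ F : Set (E d)))

theorem sameType_equivalence (d : ℕ) : Equivalence (SameType (d := d)) where
  refl _ := ⟨OrderIso.refl _, fun _ => ⟨Iff.rfl, Iff.rfl⟩⟩
  symm := by
    rintro D D' ⟨φ, h⟩
    refine ⟨φ.symm, fun F => ?_⟩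
    have := h (φ.symm F)
    rw [OrderIso.apply_symm_apply] at this
    exact ⟨this.1.symm, this.2.symm⟩
  trans := by
    rintro D D' D'' ⟨φ, h⟩ ⟨ψ, k⟩
    exact ⟨φ.trans ψ, fun F => ⟨(h F).1.trans (k (φ F)).1, (h F).2.trans (k (φ F)).2⟩⟩

/-- Combinatorial types of `d`-dimensional Dantzig figures. -/
def CombType (d : ℕ) : Type := Quotient (Setoid.mk (SameType (d := d)) (sameType_equivalence d))

/-- The combinatorial type of a Dantzig figure. -/
def Figure.type (D : Figure d) : CombType d := Quotient.mk _ D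

/-- A continuous inward move of one facet hyperplane. The polytope `P(t)`, `0 ≤ t ≤ 1`, is
`polyhedron (a t) (b t)`; its facets are cut out, one each, by the hyperplanes
`π_j(t) = hyperplane (a t j) (b t j)`; all of these are fixed except for `π_i(t)`, which moves
continuously; and `P(t) ⊆ P(s)` for `t > s`. -/
structure IsMove {n : ℕ} (i : Fin n) (a : ℝ → Fin n → E d) (b : ℝ → Fin n → ℝ) : Prop where
  continuous_normal : ContinuousOn (fun t => a t i) (Set.Icc 0 1)
  continuous_offset : ContinuousOn (fun t => b t i) (Set.Icc 0 1)
  fixed : ∀ t ∈ Set.Icc (0 : ℝ) 1, ∀ j, j ≠ i → a t j = a 0 j ∧ b t j = b 0 j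
  polytope : ∀ t ∈ Set.Icc (0 : ℝ) 1, IsPolytope (polyhedron (a t) (b t))
  facets : ∀ t ∈ Set.Icc (0 : ℝ) 1, ∀ F,
    IsFacet (polyhedron (a t) (b t)) F ↔
      ∃ j, F = polyhedron (a t) (b t) ∩ hyperplane (a t j) (b t j)
  facets_injective : ∀ t ∈ Set.Icc (0 : ℝ) 1,
    Function.Injective fun j => polyhedron (a t) (b t) ∩ hyperplane (a t j) (b t j)
  decreasing : ∀ s ∈ Set.Icc (0 : ℝ) 1, ∀ t ∈ Set.Icc (0 : ℝ) 1, s < t →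
    polyhedron (a t) (b t) ⊆ polyhedron (a s) (b s)

/-- `v` is a vertex of `P(0)` that is the intersection of some of the fixed hyperplanes. -/
def IsFixedVertex {n : ℕ} (i : Fin n) (a : ℝ → Fin n → E d) (b : ℝ → Fin n → ℝ) (v : E d) :
    Prop :=
  v ∈ (polyhedron (a 0) (b 0)).extremePoints ℝ ∧
    ∃ J : Finset (Fin n), i ∉ J ∧ {z | ∀ j ∈ J, z ∈ hyperplane (a 0 j) (b 0 j)} = {v}

/-- A fundamental deformation: a move such that `P(t)` is simple except for exactly one time
`t₀ < 1`, and such that the moving hyperplane passes through exactly one vertex `v` of `P(0)` that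
is an intersection of fixed hyperplanes; it does so at time `t₀`, and `v` is not on `P(t)` for
`t > t₀`. -/
def IsFundamentalDeformation {n : ℕ} (i : Fin n) (a : ℝ → Fin n → E d) (b : ℝ → Fin n → ℝ) :
    Prop :=
  IsMove i a b ∧
  ∃ t₀ ∈ Set.Ico (0 : ℝ) 1,
    ¬ IsSimple (polyhedron (a t₀) (b t₀)) ∧
    (∀ t ∈ Set.Icc (0 : ℝ) 1, t ≠ t₀ → IsSimple (polyhedron (a t) (b t))) ∧
    ∃ v, IsFixedVertex i a b v ∧ v ∈ hyperplane (a t₀ i) (b t₀ i) ∧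
      (∀ t ∈ Set.Ioc t₀ 1, v ∉ polyhedron (a t) (b t)) ∧
      ∀ u, IsFixedVertex i a b u →
        (∃ t ∈ Set.Icc (0 : ℝ) 1, u ∈ hyperplane (a t i) (b t i)) → u = v

/-- A move during which all the polytopes `P(t)` are simple. -/
def IsSimpleMove {n : ℕ} (i : Fin n) (a : ℝ → Fin n → E d) (b : ℝ → Fin n → ℝ) : Prop :=
  IsMove i a b ∧ ∀ t ∈ Set.Icc (0 : ℝ) 1, IsSimple (polyhedron (a t) (b t))

/-- `e` is an edge of `P(0)` that vanishes: the corresponding intersection of facets of `P(1)` is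
empty. -/
def IsVanishingEdge {n : ℕ} (a : ℝ → Fin n → E d) (b : ℝ → Fin n → ℝ) (e : Set (E d)) : Prop :=
  IsEdge (polyhedron (a 0) (b 0)) e ∧
  ∃ J : Finset (Fin n),
    e = {z ∈ polyhedron (a 0) (b 0) | ∀ j ∈ J, z ∈ hyperplane (a 0 j) (b 0 j)} ∧
    {z ∈ polyhedron (a 1) (b 1) | ∀ j ∈ J, z ∈ hyperplane (a 1 j) (b 1 j)} = ∅

/-- The family `P(t)` goes from `D` to `D'`: `P(0)` and `P(1)` are the polytopes of `D` and `D'`,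
and the distinguished vertices of `D'` lie on the facets with the same labels as those of `D`. -/
def Joins {n : ℕ} (a : ℝ → Fin n → E d) (b : ℝ → Fin n → ℝ) (D D' : Figure d) : Prop :=
  D.P = polyhedron (a 0) (b 0) ∧ D'.P = polyhedron (a 1) (b 1) ∧
  (∀ j, D.x ∈ hyperplane (a 0 j) (b 0 j) ↔ D'.x ∈ hyperplane (a 1 j) (b 1 j)) ∧
  (∀ j, D.y ∈ hyperplane (a 0 j) (b 0 j) ↔ D'.y ∈ hyperplane (a 1 j) (b 1 j))

/-- `D'` is a fundamental deformation of the Dantzig figure `D`: there is a fundamental deformation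
from `D` to `D'` none of whose vanishing edges contains a distinguished vertex of `D`. -/
def FundamentalDeformation (D D' : Figure d) : Prop :=
  ∃ (n : ℕ) (i : Fin n) (a : ℝ → Fin n → E d) (b : ℝ → Fin n → ℝ),
    IsFundamentalDeformation i a b ∧ Joins a b D D' ∧
    ∀ e, IsVanishingEdge a b e → D.x ∉ e ∧ D.y ∉ e

/-- `D'` arises from `D` by a move of one facet hyperplane through simple polytopes only. -/
def SimpleMove (D D' : Figure d) : Prop :=
  ∃ (n : ℕ) (i : Fin n) (a : ℝ → Fin n → E d) (b : ℝ → Fin n → ℝ),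
    IsSimpleMove i a b ∧ Joins a b D D'

/-- The moduli-graph `D(d)`: its vertices are the combinatorial types of `d`-dimensional Dantzig
figures, with an arrow from the type of `D` to the type of `D'` whenever `D'` is a fundamental
deformation of `D`. -/
def moduliGraph (d : ℕ) : Digraph (CombType d) where
  Adj σ τ := ∃ D D' : Figure d, D.type = σ ∧ D'.type = τ ∧ FundamentalDeformation D D'

/-- A directed graph is strongly connected if any vertex is joined to any other by a directed
path. -/
def StronglyConnected {V : Type*} (G : Digraph V) : Prop :=
  ∀ u v : V, Relation.ReflTransGen G.Adj u v

end Dantzig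

/-! Describe a figure by its `d + d` facet inequalities, the first `d` tight at `x` and the others
at `y`. With the first `d` slacks as coordinates, normalized to be 0 at `x` and 1 at `y`, the last
`d` inequalities become `⟨M i, z⟩ ≤ 1`, where every row of `M` has sum 1. Adding one non-negative
vector to all rows is a projective transformation that preserves the sets of tight constraints,
hence the combinatorial type (`Describes.activeSets_eq`). So the type depends only on the
differences of the rows, which form an invertible matrix `A` of size `d - 1`, and the common summand
can be made as large as desired. For `d ≥ 3` the facets at `x` can be relabelled so that `A` has
positive determinant (`exists_hasDifferences`).

Matrices of positive determinant are joined by a polygonal path of invertible matrices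
(`linked_of_det_mul_pos`). Raising the common summand fast enough along the way makes all entries of
the system increase strictly, so that the facets at `y` only move inwards, while the system keeps
its `d + d` facets and its vertex `y` (`SegInv.climbs`).

Such a path is followed by moving one row at a time inside small balls of good systems, in generic
positive directions. Simplicity is lost exactly when the moving hyperplane meets a vertex not on its
facet (`exists_fixedVertex_of_not_nondegenerate`), and a generic direction makes it meet these
vertices one at a time (`exists_generic_direction`). A row move thus splits into fundamental
deformations and simple moves (`chain_rowMove`). The condition on vanishing edges is automatic,
since `x` and `y` stay on their facets. Genericity prevents reaching the target system exactly, but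
the type of a nondegenerate system is locally constant (`eventually_activeSets_eq`), so reaching a
nearby system suffices. -/

namespace Dantzig

variable {d : ℕ}

/-! ### Active sets and faces of polyhedra -/

section ActiveSets

variable {n : ℕ} (a : Fin n → E d) (b : Fin n → ℝ)

/-- The constraints that are tight at `z`. -/
def act (z : E d) : Set (Fin n) := {j | inner ℝ (a j) z = b j}

/-- All sets of constraints that are the set of tight constraints of some point. -/
def activeSets : Set (Set (Fin n)) := act a b '' polyhedron a b

/-- The points of the polyhedron at which all constraints in `J` are tight. -/
def faceOf (J : Set (Fin n)) : Set (E d) := {z ∈ polyhedron a b | J ⊆ act a b z}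

variable {a b}

theorem mem_act {z : E d} {j : Fin n} : j ∈ act a b z ↔ inner ℝ (a j) z = b j := Iff.rfl

theorem lt_of_notMem_act {z : E d} {j : Fin n} (hz : z ∈ polyhedron a b) (hj : j ∉ act a b z) :
    inner ℝ (a j) z < b j :=
  lt_of_le_of_ne (hz j) hj

variable (a b)

theorem convex_polyhedron : Convex ℝ (polyhedron a b) := by
  intro x hx y hy s t hs ht hst j
  rw [inner_add_right, real_inner_smul_right, real_inner_smul_right]
  have := mul_le_mul_of_nonneg_left (hx j) hs
  have := mul_le_mul_of_nonneg_left (hy j) ht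
  calc _ ≤ s * b j + t * b j := by linarith
    _ = b j := by rw [← add_mul, hst, one_mul]

theorem isClosed_polyhedron : IsClosed (polyhedron a b) := by
  have : polyhedron a b = ⋂ j, {z | inner ℝ (a j) z ≤ b j} := by
    ext; simp [polyhedron]
  rw [this]
  exact isClosed_iInter fun j => isClosed_le (by fun_prop) continuous_const

theorem faceOf_subset (J : Set (Fin n)) : faceOf a b J ⊆ polyhedron a b := fun _ h => h.1

theorem isClosed_faceOf (J : Set (Fin n)) : IsClosed (faceOf a b J) := by
  have : faceOf a b J = polyhedron a b ∩ ⋂ j ∈ J, {z | inner ℝ (a j) z = b j} := by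
    ext; simp [faceOf, Set.subset_def, mem_act]
  rw [this]
  exact (isClosed_polyhedron a b).inter
    (isClosed_biInter fun j _ => isClosed_eq (by fun_prop) continuous_const)

/-- The sum of the normals in `J` exposes the face: once some point makes all constraints in `J`
tight, the maximum is attained exactly where every summand is tight. -/
theorem isFace_faceOf (J : Set (Fin n)) : IsFace (polyhedron a b) (faceOf a b J) := by
  classical
  rintro ⟨z, hz⟩
  let c : Fin n → ℝ := fun j => if j ∈ J then 1 else 0
  have hc : ∀ j, 0 ≤ c j := fun j => by simp only [c]; split_ifs <;> norm_num
  refine ⟨∑ j, c j • innerSL ℝ (a j), ?_⟩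
  have hl : ∀ x, (∑ j, c j • innerSL ℝ (a j)) x = ∑ j, c j * inner ℝ (a j) x := fun x => by
    simp
  have hle : ∀ x ∈ polyhedron a b, ∑ j, c j * inner ℝ (a j) x ≤ ∑ j, c j * b j := fun x hx =>
    Finset.sum_le_sum fun j _ => mul_le_mul_of_nonneg_left (hx j) (hc j)
  have heq : ∀ x ∈ faceOf a b J, ∑ j, c j * inner ℝ (a j) x = ∑ j, c j * b j := fun x hx =>
    Finset.sum_congr rfl fun j _ => by
      by_cases hj : j ∈ J
      · rw [mem_act.1 (hx.2 hj)]
      · simp [c, hj]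
  ext x
  simp only [Set.mem_ofPred_eq, hl]
  refine ⟨fun hx => ⟨hx.1, fun y hy => (hle y hy).trans (heq x hx).ge⟩, fun hx => ⟨hx.1, ?_⟩⟩
  have h1 : ∑ j, c j * inner ℝ (a j) x = ∑ j, c j * b j :=
    le_antisymm (hle x hx.1) ((heq z hz).ge.trans (hx.2 z hz.1))
  have h2 := (Finset.sum_eq_sum_iff_of_le fun j _ =>
    mul_le_mul_of_nonneg_left (hx.1 j) (hc j)).1 h1
  intro j hj
  simpa [c, hj, mem_act] using h2 j (Finset.mem_univ j)

theorem act_midpoint {x z : E d} (hx : x ∈ polyhedron a b) (hz : z ∈ polyhedron a b) :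
    act a b ((1 / 2 : ℝ) • x + (1 / 2 : ℝ) • z) = act a b x ∩ act a b z := by
  ext j
  simp only [Set.mem_inter_iff, mem_act, inner_add_right, real_inner_smul_right]
  have := hx j
  have := hz j
  constructor
  · intro h; constructor <;> linarith
  · rintro ⟨h, k⟩; linarith

/-- A non-empty convex subset contains a point with the least set of tight constraints. -/
theorem exists_act_subset {F : Set (E d)} (hF : F ⊆ polyhedron a b) (hconv : Convex ℝ F)
    (hne : F.Nonempty) : ∃ z ∈ F, ∀ x ∈ F, act a b z ⊆ act a b x := by
  obtain ⟨z, hz, hmin⟩ : ∃ z ∈ F, ∀ x ∈ F, (act a b z).ncard ≤ (act a b x).ncard := by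
    exact ⟨_, Function.argminOn_mem (fun z => (act a b z).ncard) F hne, fun x hx =>
      Function.argminOn_le (fun z => (act a b z).ncard) F hx⟩
  refine ⟨z, hz, fun x hx => ?_⟩
  -- The midpoint has tight set `act a b z ∩ act a b x`, which by minimality is no smaller than `act
  -- a b z`.
  have hmid := hconv hz hx (by norm_num : (0 : ℝ) ≤ 1 / 2) (by norm_num : (0 : ℝ) ≤ 1 / 2)
    (by norm_num)
  have h := hmin _ hmid
  rw [act_midpoint a b (hF hz) (hF hx)] at h
  have := Set.eq_of_subset_of_ncard_le (Set.inter_subset_left (s := act a b z) (t := act a b x)) h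
    (Set.toFinite _)
  exact Set.inter_eq_left.1 this

theorem exists_pos_forall_mem {ι : Type*} [Finite ι] (f g : ι → ℝ) (h : ∀ i, 0 < f i) :
    ∃ ε > (0 : ℝ), ∀ i, ε * g i < f i := by
  have : ∀ i, ∀ᶠ ε in nhdsWithin (0 : ℝ) (Set.Ioi 0), ε * g i < f i := fun i => by
    have : Filter.Tendsto (fun ε : ℝ => ε * g i) (nhdsWithin 0 (Set.Ioi 0)) (nhds (0 * g i)) :=
      ((continuous_id.mul continuous_const).tendsto (0 : ℝ)).mono_left nhdsWithin_le_nhds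
    rw [zero_mul] at this
    exact this.eventually_lt_const (h i)
  obtain ⟨ε, h1, h2⟩ := ((Filter.eventually_all.2 this).and self_mem_nhdsWithin).exists
  exact ⟨ε, h2, h1⟩

/-- A direction along which all tight constraints do not increase can be followed for some time. -/
theorem exists_pos_add_smul_mem {z u : E d} (hz : z ∈ polyhedron a b)
    (hu : ∀ j ∈ act a b z, inner ℝ (a j) u ≤ 0) :
    ∃ ε > (0 : ℝ), z + ε • u ∈ polyhedron a b ∧
      act a b (z + ε • u) = {j ∈ act a b z | inner ℝ (a j) u = 0} := by
  obtain ⟨ε, hε, h⟩ := exists_pos_forall_mem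
    (fun j : {j // j ∉ act a b z} => b j - inner ℝ (a j) z) (fun j => inner ℝ (a j) u)
    fun j => sub_pos.2 (lt_of_notMem_act hz j.2)
  have key : ∀ j, inner ℝ (a j) (z + ε • u) = inner ℝ (a j) z + ε * inner ℝ (a j) u := fun j => by
    rw [inner_add_right, real_inner_smul_right]
  refine ⟨ε, hε, fun j => ?_, Set.ext fun j => ?_⟩
  · rw [key]
    by_cases hj : j ∈ act a b z
    · have := mul_nonneg hε.le (neg_nonneg.2 (hu j hj))
      have := hz j
      linarith
    · have := h ⟨j, hj⟩
      simp only at this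
      linarith
  · rw [mem_act, key]
    by_cases hj : j ∈ act a b z
    · simp [hj, mem_act.1 hj, hε.ne']
    · have := h ⟨j, hj⟩
      simp only at this
      simp only [hj, false_and, Set.mem_ofPred_eq, iff_false]
      linarith

/-- Choose `z` in the face with the least tight set. If these constraints are also tight at `x`, the
segment from `x` to `z` can be prolonged beyond `z`, so the exposing functional is not smaller at
`x` than at its maximizer `z`. -/
theorem isFace_iff {F : Set (E d)} :
    IsFace (polyhedron a b) F ↔ F = ∅ ∨ ∃ J, F = faceOf a b J := by
  constructor
  · intro h
    rcases F.eq_empty_or_nonempty with hF | hF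
    · exact Or.inl hF
    · right
      obtain ⟨z, hz, hmin⟩ := exists_act_subset a b h.subset
        (IsExposed.convex h (convex_polyhedron a b)) hF
      refine ⟨act a b z, Set.Subset.antisymm (fun x hx => ⟨h.subset hx, hmin x hx⟩) ?_⟩
      obtain ⟨l, hl⟩ := h hF
      rw [hl] at hz
      rintro x ⟨hx, hJ⟩
      obtain ⟨ε, hε, hmem, -⟩ := exists_pos_add_smul_mem a b (u := z - x) hz.1 fun j hj => by
        rw [inner_sub_right, mem_act.1 hj, mem_act.1 (hJ hj), sub_self]
      have h1 := hz.2 _ hmem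
      rw [map_add, map_smul, map_sub, smul_eq_mul] at h1
      have h2 : l z ≤ l x := by
        by_contra hlt
        have := mul_pos hε (sub_pos.2 (not_le.1 hlt))
        linarith
      rw [hl]
      exact ⟨hx, fun y hy => (hz.2 y hy).trans h2⟩
  · rintro (rfl | ⟨J, rfl⟩)
    · rintro ⟨x, hx⟩
      exact hx.elim
    · exact isFace_faceOf a b J

end ActiveSets

/-! ### Tight sets determine the face poset -/

section Transport

variable {d' n : ℕ} {a : Fin n → E d} {b : Fin n → ℝ} {a' : Fin n → E d'} {b' : Fin n → ℝ}

/-- The face of the second polyhedron with the same sets of tight constraints. -/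
def transport (a : Fin n → E d) (b : Fin n → ℝ) (a' : Fin n → E d') (b' : Fin n → ℝ)
    (F : Set (E d)) : Set (E d') :=
  {z | z ∈ polyhedron a' b' ∧ ∃ w ∈ F, act a b w = act a' b' z}

theorem transport_faceOf (h : activeSets a b = activeSets a' b') (J : Set (Fin n)) :
    transport a b a' b' (faceOf a b J) = faceOf a' b' J := by
  ext z
  constructor
  · rintro ⟨hz, w, hw, e⟩
    exact ⟨hz, e ▸ hw.2⟩
  · rintro ⟨hz, hJ⟩
    have : act a' b' z ∈ activeSets a b := h ▸ ⟨z, hz, rfl⟩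
    obtain ⟨w, hw, e⟩ := this
    exact ⟨hz, w, ⟨hw, e ▸ hJ⟩, e⟩

theorem transport_empty : transport a b a' b' ∅ = ∅ := by
  ext; simp [transport]

theorem isFace_transport (h : activeSets a b = activeSets a' b') {F : Set (E d)}
    (hF : IsFace (polyhedron a b) F) : IsFace (polyhedron a' b') (transport a b a' b' F) := by
  rw [isFace_iff] at hF ⊢
  rcases hF with rfl | ⟨J, rfl⟩
  · exact Or.inl transport_empty
  · exact Or.inr ⟨J, transport_faceOf h J⟩

theorem transport_transport (h : activeSets a b = activeSets a' b') {F : Set (E d)}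
    (hF : IsFace (polyhedron a b) F) :
    transport a' b' a b (transport a b a' b' F) = F := by
  rw [isFace_iff] at hF
  rcases hF with rfl | ⟨J, rfl⟩
  · rw [transport_empty, transport_empty]
  · rw [transport_faceOf h, transport_faceOf h.symm]

theorem transport_mono {F G : Set (E d)} (h : F ⊆ G) :
    transport a b a' b' F ⊆ transport a b a' b' G := by
  rintro z ⟨hz, w, hw, e⟩
  exact ⟨hz, w, h hw, e⟩

theorem mem_iff_mem_transport (h : activeSets a b = activeSets a' b') {F : Set (E d)}
    (hF : IsFace (polyhedron a b) F) {x : E d} {x' : E d'} (hx : x ∈ polyhedron a b)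
    (hx' : x' ∈ polyhedron a' b') (e : act a b x = act a' b' x') :
    x ∈ F ↔ x' ∈ transport a b a' b' F := by
  rw [isFace_iff] at hF
  rcases hF with rfl | ⟨J, rfl⟩
  · simp [transport_empty]
  · rw [transport_faceOf h]
    simp [faceOf, hx, hx', e]

/-- Polyhedra with the same sets of tight constraints have isomorphic face posets. -/
def faceIso (h : activeSets a b = activeSets a' b') :
    FacePoset (polyhedron a b) ≃o FacePoset (polyhedron a' b') where
  toFun F := ⟨transport a b a' b' F, isFace_transport h F.2⟩
  invFun F := ⟨transport a' b' a b F, isFace_transport h.symm F.2⟩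
  left_inv F := Subtype.ext (transport_transport h F.2)
  right_inv F := Subtype.ext (transport_transport h.symm F.2)
  map_rel_iff' := by
    intro F G
    refine ⟨fun hFG => ?_, fun hFG => transport_mono hFG⟩
    have := transport_mono (a := a') (b := b') (a' := a) (b' := b) hFG
    rwa [Equiv.coe_fn_mk, transport_transport h F.2, transport_transport h G.2] at this

end Transport

theorem Figure.x_mem (D : Figure d) : D.x ∈ D.P := D.x_vertex.1

theorem Figure.y_mem (D : Figure d) : D.y ∈ D.P := D.y_vertex.1

theorem sameType_of_activeSets_eq {n : ℕ} {a a' : Fin n → E d} {b b' : Fin n → ℝ}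
    {D D' : Figure d} (hP : D.P = polyhedron a b) (hP' : D'.P = polyhedron a' b')
    (h : activeSets a b = activeSets a' b') (hx : act a b D.x = act a' b' D'.x)
    (hy : act a b D.y = act a' b' D'.y) : SameType D D' := by
  have h1 := D.x_mem
  have h2 := D.y_mem
  have h3 := D'.x_mem
  have h4 := D'.y_mem
  unfold SameType
  rw [hP] at h1 h2
  rw [hP'] at h3 h4
  rw [hP, hP']
  exact ⟨faceIso h, fun F => ⟨mem_iff_mem_transport h F.2 h1 h3 hx,
    mem_iff_mem_transport h F.2 h2 h4 hy⟩⟩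

/-! ### Vertices -/

/-- The functional `v j ↦ c j` on the span extends to the whole space and is represented by a
vector. -/
theorem exists_inner_eq_of_linearIndependent {ι : Type*} {v : ι → E d}
    (h : LinearIndependent ℝ v) (c : ι → ℝ) : ∃ u, ∀ j, inner ℝ (v j) u = c j := by
  obtain ⟨f, hf⟩ := ((Finsupp.linearCombination ℝ c) ∘ₗ h.repr).exists_extend
  refine ⟨(InnerProductSpace.toDual ℝ (E d)).symm f.toContinuousLinearMap, fun j => ?_⟩
  rw [real_inner_comm, InnerProductSpace.toDual_symm_apply]
  have h1 := LinearMap.congr_fun hf ⟨v j, Submodule.subset_span ⟨j, rfl⟩⟩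
  have h2 : h.repr ⟨v j, Submodule.subset_span ⟨j, rfl⟩⟩ = Finsupp.single j 1 :=
    h.repr_eq_single j _ rfl
  simp only [LinearMap.comp_apply, h2] at h1
  simpa using h1

section Vertices

variable {n : ℕ} {a : Fin n → E d} {b : Fin n → ℝ}

theorem act_subset_of_mem_openSegment {x y z : E d} (hx : x ∈ polyhedron a b)
    (hy : y ∈ polyhedron a b) (hz : z ∈ openSegment ℝ x y) : act a b z ⊆ act a b x := by
  obtain ⟨s, t, hs, ht, hst, rfl⟩ := hz
  intro j hj
  rw [mem_act, inner_add_right, real_inner_smul_right, real_inner_smul_right] at hj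
  have h1 := mul_le_mul_of_nonneg_left (hy j) ht.le
  have h2 : s * b j + t * b j = b j := by rw [← add_mul, hst, one_mul]
  exact le_antisymm (hx j) (le_of_mul_le_mul_left (by linarith) hs)

/-- A non-zero `u` orthogonal to all tight normals would put `z` inside a segment parallel to `u`.
Conversely, whatever is tight at `z` is tight at both ends of any segment around `z`. -/
theorem mem_extremePoints_iff {z : E d} : z ∈ (polyhedron a b).extremePoints ℝ ↔
    z ∈ polyhedron a b ∧ ∀ u, (∀ j ∈ act a b z, inner ℝ (a j) u = 0) → u = 0 := by
  constructor
  · intro hz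
    refine ⟨hz.1, fun u hu => ?_⟩
    obtain ⟨ε, hε, h1, -⟩ := exists_pos_add_smul_mem a b hz.1 fun j hj => (hu j hj).le
    obtain ⟨δ, hδ, h2, -⟩ := exists_pos_add_smul_mem a b (u := -u) hz.1 fun j hj => by
      rw [inner_neg_right, hu j hj, neg_zero]
    have hmem : z ∈ openSegment ℝ (z + ε • u) (z + δ • -u) := by
      have hpos : 0 < ε + δ := add_pos hε hδ
      refine ⟨δ / (ε + δ), ε / (ε + δ), by positivity, by positivity, by field_simp; ring, ?_⟩
      have e1 : δ / (ε + δ) + ε / (ε + δ) = 1 := by field_simp; ring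
      have e2 : δ / (ε + δ) * ε - ε / (ε + δ) * δ = 0 := by ring
      calc _ = (δ / (ε + δ) + ε / (ε + δ)) • z +
          (δ / (ε + δ) * ε - ε / (ε + δ) * δ) • u := by module
        _ = z := by rw [e1, e2]; simp
    have := hz.2 h1 h2 hmem
    have h3 : ε • u = 0 := by simpa using this
    exact (smul_eq_zero.1 h3).resolve_left hε.ne'
  · rintro ⟨hz, h⟩
    refine mem_extremePoints.2 ⟨hz, fun x hx y hy hxy => ?_⟩
    have h1 := act_subset_of_mem_openSegment hx hy hxy
    have h2 := act_subset_of_mem_openSegment hy hx (openSegment_symm ℝ x y ▸ hxy)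
    have hx0 := h (x - z) fun j hj => by
      rw [inner_sub_right, mem_act.1 (h1 hj), mem_act.1 hj, sub_self]
    have hy0 := h (y - z) fun j hj => by
      rw [inner_sub_right, mem_act.1 (h2 hj), mem_act.1 hj, sub_self]
    exact ⟨sub_eq_zero.1 hx0, sub_eq_zero.1 hy0⟩

theorem span_eq_top_of_forall_inner {J : Set (Fin n)}
    (h : ∀ u, (∀ j ∈ J, inner ℝ (a j) u = 0) → u = 0) :
    Submodule.span ℝ (Set.range fun j : J => a j) = ⊤ := by
  rw [← Submodule.orthogonal_eq_bot_iff, Submodule.eq_bot_iff]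
  intro u hu
  exact h u fun j hj => (Submodule.mem_orthogonal _ _).1 hu _ (Submodule.subset_span ⟨⟨j, hj⟩, rfl⟩)

theorem le_ncard_of_forall_inner {J : Set (Fin n)}
    (h : ∀ u, (∀ j ∈ J, inner ℝ (a j) u = 0) → u = 0) : d ≤ J.ncard := by
  classical
  have h1 := finrank_range_le_card (R := ℝ) (fun j : J => a j)
  rw [Set.finrank, span_eq_top_of_forall_inner h, finrank_top, finrank_euclideanSpace_fin] at h1
  rwa [← Nat.card_coe_set_eq, Nat.card_eq_fintype_card]

theorem linearIndepOn_of_forall_inner {J : Set (Fin n)}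
    (h : ∀ u, (∀ j ∈ J, inner ℝ (a j) u = 0) → u = 0) (hcard : J.ncard ≤ d) :
    LinearIndepOn ℝ a J := by
  classical
  refine linearIndependent_of_top_le_span_of_card_eq_finrank
    (span_eq_top_of_forall_inner h).ge ?_
  rw [finrank_euclideanSpace_fin, ← Nat.card_eq_fintype_card, Nat.card_coe_set_eq]
  exact le_antisymm hcard (le_ncard_of_forall_inner h)

theorem forall_inner_of_linearIndepOn {J : Set (Fin n)} (h : LinearIndepOn ℝ a J)
    (hcard : J.ncard = d) (u : E d) (hu : ∀ j ∈ J, inner ℝ (a j) u = 0) : u = 0 := by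
  classical
  have h1 : Submodule.span ℝ (Set.range fun j : J => a j) = ⊤ := by
    refine LinearIndependent.span_eq_top_of_card_eq_finrank' h ?_
    rw [finrank_euclideanSpace_fin, ← Nat.card_eq_fintype_card, Nat.card_coe_set_eq, hcard]
  have h2 : u ∈ (Submodule.span ℝ (Set.range fun j : J => a j))ᗮ := by
    rw [← Submodule.span_singleton_le_iff_mem, Submodule.le_orthogonal_iff_le_orthogonal,
      Submodule.span_le]
    rintro _ ⟨j, rfl⟩
    rw [SetLike.mem_coe, Submodule.mem_orthogonal_singleton_iff_inner_left]
    exact hu j j.2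
  rwa [h1, Submodule.top_orthogonal_eq_bot, Submodule.mem_bot] at h2

/-- The least face through `z` is compact, so it has an extreme point, and extreme points of a face
are extreme in the polyhedron. -/
theorem exists_extremePoint_act_subset (hb : Bornology.IsBounded (polyhedron a b)) {z : E d}
    (hz : z ∈ polyhedron a b) :
    ∃ v ∈ (polyhedron a b).extremePoints ℝ, act a b z ⊆ act a b v := by
  have hc : IsCompact (faceOf a b (act a b z)) :=
    Metric.isCompact_of_isClosed_isBounded (isClosed_faceOf a b _) (hb.subset (faceOf_subset a b _))
  obtain ⟨v, hv⟩ := hc.extremePoints_nonempty ⟨z, hz, subset_rfl⟩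
  exact ⟨v, (IsExposed.isExtreme (isFace_faceOf a b _)).extremePoints_subset_extremePoints hv,
    hv.1.2⟩

/-- No point lies on more than `d` of the hyperplanes. -/
def Nondegenerate (a : Fin n → E d) (b : Fin n → ℝ) : Prop :=
  ∀ z ∈ polyhedron a b, (act a b z).ncard ≤ d

theorem nondegenerate_of_extremePoints (hb : Bornology.IsBounded (polyhedron a b))
    (h : ∀ v ∈ (polyhedron a b).extremePoints ℝ, (act a b v).ncard ≤ d) : Nondegenerate a b := by
  intro z hz
  obtain ⟨v, hv, hzv⟩ := exists_extremePoint_act_subset hb hz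
  exact (Set.ncard_le_ncard hzv).trans (h v hv)

/-- Enlarge the tight set to that of a vertex: its normals span the space and there are at most `d`
of them. -/
theorem Nondegenerate.linearIndepOn (h : Nondegenerate a b)
    (hb : Bornology.IsBounded (polyhedron a b)) {z : E d} (hz : z ∈ polyhedron a b) :
    LinearIndepOn ℝ a (act a b z) := by
  obtain ⟨v, hv, hzv⟩ := exists_extremePoint_act_subset hb hz
  exact (linearIndepOn_of_forall_inner (mem_extremePoints_iff.1 hv).2 (h v hv.1)).mono hzv

/-- In a nondegenerate bounded system, every subset of tight constraints is the set of tight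
constraints of some point. -/
theorem Nondegenerate.mem_activeSets_of_subset (h : Nondegenerate a b)
    (hb : Bornology.IsBounded (polyhedron a b)) {z : E d} (hz : z ∈ polyhedron a b)
    {J : Set (Fin n)} (hJ : J ⊆ act a b z) : J ∈ activeSets a b := by
  classical
  -- The direction `u` keeps the constraints in `J` tight and loosens the other tight ones.
  obtain ⟨u, hu⟩ := exists_inner_eq_of_linearIndependent (h.linearIndepOn hb hz)
    fun j => if (j : Fin n) ∈ J then 0 else -1
  obtain ⟨ε, -, h1, h2⟩ := exists_pos_add_smul_mem a b hz (u := u) fun j hj => by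
    have := hu ⟨j, hj⟩
    simp only at this
    rw [this]; split_ifs <;> norm_num
  refine ⟨_, h1, h2.trans (Set.ext fun j => ?_)⟩
  simp only [Set.mem_ofPred_eq]
  constructor
  · rintro ⟨hj, e⟩
    have := hu ⟨j, hj⟩
    simp only [e] at this
    by_contra hn
    simp [hn] at this
  · intro hj
    have := hu ⟨j, hJ hj⟩
    simp only [hj, if_true] at this
    exact ⟨hJ hj, this⟩

end Vertices

/-! ### Facets of irredundant systems -/

section Facets

variable {n : ℕ} {a : Fin n → E d} {b : Fin n → ℝ}

/-- The system has an interior point and each constraint is the only tight one somewhere. -/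
structure Irredundant (a : Fin n → E d) (b : Fin n → ℝ) : Prop where
  slack : ∃ z ∈ polyhedron a b, act a b z = ∅
  tight : ∀ j, ∃ z ∈ polyhedron a b, act a b z = {j}

theorem mem_vectorSpan_faceOf_act {z : E d} (hz : z ∈ polyhedron a b) {u : E d} :
    u ∈ vectorSpan ℝ (faceOf a b (act a b z)) ↔ ∀ j ∈ act a b z, inner ℝ (a j) u = 0 := by
  constructor
  · intro hu j hj
    rw [← Submodule.mem_orthogonal_singleton_iff_inner_right]
    refine (Submodule.span_le.2 ?_ : vectorSpan ℝ (faceOf a b (act a b z)) ≤ _) hu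
    rintro _ ⟨x, hx, y, hy, rfl⟩
    rw [SetLike.mem_coe, Submodule.mem_orthogonal_singleton_iff_inner_right]
    change inner ℝ (a j) (x - y) = 0
    rw [inner_sub_right, mem_act.1 (hx.2 hj), mem_act.1 (hy.2 hj), sub_self]
  · intro hu
    obtain ⟨ε, hε, h1, h2⟩ := exists_pos_add_smul_mem a b hz fun j hj => (hu j hj).le
    have h3 : z + ε • u ∈ faceOf a b (act a b z) := ⟨h1, fun j hj => h2 ▸ ⟨hj, hu j hj⟩⟩
    have h4 := vsub_mem_vectorSpan ℝ h3 (⟨hz, subset_rfl⟩ : z ∈ faceOf a b (act a b z))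
    rw [vsub_eq_sub, add_sub_cancel_left] at h4
    exact (Submodule.smul_mem_iff _ hε.ne').1 h4

namespace Irredundant

theorem normal_ne_zero (h : Irredundant a b) (j : Fin n) : a j ≠ 0 := by
  intro h0
  obtain ⟨z, -, hz⟩ := h.slack
  obtain ⟨w, -, hw⟩ := h.tight j
  have h1 : j ∈ act a b w := hw ▸ rfl
  have h2 : j ∉ act a b z := by simp [hz]
  rw [mem_act, h0, inner_zero_left] at h1 h2
  exact h2 h1

theorem faceOf_singleton (j : Fin n) :
    faceOf a b {j} = polyhedron a b ∩ hyperplane (a j) (b j) := by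
  ext; simp [faceOf, hyperplane, mem_act]

theorem vectorSpan_facet (h : Irredundant a b) (j : Fin n) :
    vectorSpan ℝ (faceOf a b {j}) = (ℝ ∙ a j)ᗮ := by
  obtain ⟨z, hz, e⟩ := h.tight j
  ext u
  rw [← e, mem_vectorSpan_faceOf_act hz, e, Submodule.mem_orthogonal_singleton_iff_inner_right]
  simp

theorem finrank_orthogonal (h : Irredundant a b) (j : Fin n) :
    Module.finrank ℝ (ℝ ∙ a j)ᗮ + 1 = d := by
  have := (ℝ ∙ a j).finrank_add_finrank_orthogonal
  rw [finrank_span_singleton (h.normal_ne_zero j), finrank_euclideanSpace_fin] at this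
  omega

/-- A face on which `J` is tight has directions orthogonal to all `a k`, `k ∈ J`. Dimension `d - 1`
makes these hyperplanes of directions coincide, so a point where only `j ∈ J` is tight makes all of
`J` tight, whence `J = {j}`. For empty `J` the dimension is `d`. -/
theorem isFacet_iff (h : Irredundant a b) {F : Set (E d)} : IsFacet (polyhedron a b) F ↔
    ∃ j, F = polyhedron a b ∩ hyperplane (a j) (b j) := by
  constructor
  · rintro ⟨hF, hne, hdim⟩
    rw [isFace_iff] at hF
    obtain ⟨J, rfl⟩ := hF.resolve_left hne.ne_empty
    rcases J.eq_empty_or_nonempty with rfl | ⟨j, hj⟩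
    · obtain ⟨z, hz, e⟩ := h.slack
      have : vectorSpan ℝ (faceOf a b ∅) = ⊤ := by
        rw [← e, eq_top_iff]
        intro u _
        rw [mem_vectorSpan_faceOf_act hz, e]
        simp
      rw [this, finrank_top, finrank_euclideanSpace_fin] at hdim
      omega
    · refine ⟨j, ?_⟩
      rw [← faceOf_singleton]
      have hle : ∀ k ∈ J, vectorSpan ℝ (faceOf a b J) ≤ (ℝ ∙ a k)ᗮ := fun k hk => by
        rw [← h.vectorSpan_facet]
        exact vectorSpan_mono ℝ fun x hx => ⟨hx.1, by simpa using hx.2 hk⟩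
      have heq : ∀ k ∈ J, vectorSpan ℝ (faceOf a b J) = (ℝ ∙ a k)ᗮ := fun k hk => by
        refine Submodule.eq_of_le_of_finrank_eq (hle k hk) ?_
        have := h.finrank_orthogonal k
        omega
      obtain ⟨z, hz, e⟩ := h.tight j
      obtain ⟨f, hf⟩ := hne
      have hzf : z - f ∈ (ℝ ∙ a j)ᗮ := by
        have h1 : j ∈ act a b z := e ▸ rfl
        rw [Submodule.mem_orthogonal_singleton_iff_inner_right, inner_sub_right, mem_act.1 h1,
          mem_act.1 (hf.2 hj), sub_self]
      have hsub : J ⊆ act a b z := fun k hk => by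
        rw [← heq j hj, heq k hk, Submodule.mem_orthogonal_singleton_iff_inner_right,
          inner_sub_right, mem_act.1 (hf.2 hk), sub_eq_zero] at hzf
        exact hzf
      rw [e] at hsub
      rw [Set.Subset.antisymm hsub (Set.singleton_subset_iff.2 hj)]
  · rintro ⟨j, rfl⟩
    rw [← faceOf_singleton]
    obtain ⟨z, hz, e⟩ := h.tight j
    refine ⟨isFace_faceOf a b _, ⟨z, hz, e.ge⟩, ?_⟩
    rw [h.vectorSpan_facet]
    exact h.finrank_orthogonal j

theorem facet_injective (h : Irredundant a b) :
    Function.Injective fun j => polyhedron a b ∩ hyperplane (a j) (b j) := by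
  intro j k hjk
  simp only [← faceOf_singleton] at hjk
  obtain ⟨z, hz, e⟩ := h.tight k
  have : z ∈ faceOf a b {j} := by rw [hjk]; exact ⟨hz, e.ge⟩
  have := this.2 rfl
  rwa [e] at this

theorem ncard_facets (h : Irredundant a b) : {F | IsFacet (polyhedron a b) F}.ncard = n := by
  have : {F | IsFacet (polyhedron a b) F} =
      (fun j => polyhedron a b ∩ hyperplane (a j) (b j)) '' Set.univ := by
    ext F; simp [h.isFacet_iff, eq_comm]
  rw [this, Set.ncard_image_of_injective _ h.facet_injective, Set.ncard_univ, Nat.card_fin]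

theorem ncard_facets_mem (h : Irredundant a b) {v : E d} (hv : v ∈ polyhedron a b) :
    {F | IsFacet (polyhedron a b) F ∧ v ∈ F}.ncard = (act a b v).ncard := by
  have : {F | IsFacet (polyhedron a b) F ∧ v ∈ F} =
      (fun j => polyhedron a b ∩ hyperplane (a j) (b j)) '' act a b v := by
    ext F
    simp only [h.isFacet_iff, Set.mem_ofPred_eq, Set.mem_image]
    constructor
    · rintro ⟨⟨j, rfl⟩, hF⟩
      exact ⟨j, hF.2, rfl⟩
    · rintro ⟨j, hj, rfl⟩
      exact ⟨⟨j, rfl⟩, hv, hj⟩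
  rw [this, Set.ncard_image_of_injective _ h.facet_injective]

theorem isPolytope (h : Irredundant a b) (hb : Bornology.IsBounded (polyhedron a b)) :
    IsPolytope (polyhedron a b) := by
  refine ⟨⟨n, a, b, rfl⟩, hb, ?_⟩
  obtain ⟨z, hz, e⟩ := h.slack
  refine ⟨z, mem_interior.2 ⟨⋂ j, {w | inner ℝ (a j) w < b j}, fun w hw j => ?_, ?_, ?_⟩⟩
  · exact (Set.mem_iInter.1 hw j).le
  · exact isOpen_iInter_of_finite fun j => isOpen_lt (by fun_prop) continuous_const
  · exact Set.mem_iInter.2 fun j => lt_of_notMem_act hz (by simp [e])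

/-- At least `d` constraints are tight at any vertex, and the tight set of any point is contained in
that of a vertex. -/
theorem isSimple_iff (h : Irredundant a b) (hb : Bornology.IsBounded (polyhedron a b)) :
    IsSimple (polyhedron a b) ↔ Nondegenerate a b := by
  constructor
  · intro hs
    refine nondegenerate_of_extremePoints hb fun v hv => ?_
    rw [← h.ncard_facets_mem hv.1]
    exact (hs.2 v hv).le
  · intro hn
    refine ⟨h.isPolytope hb, fun v hv => ?_⟩
    rw [h.ncard_facets_mem hv.1]
    exact le_antisymm (hn v hv.1) (le_ncard_of_forall_inner (mem_extremePoints_iff.1 hv).2)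

end Irredundant

/-! ### Irredundant systems for polytopes and Dantzig figures -/

/-- Every polytope is given by an irredundant system. -/
theorem exists_irredundant {P : Set (E d)} (hP : IsPolytope P) :
    ∃ (n : ℕ) (a : Fin n → E d) (b : Fin n → ℝ), P = polyhedron a b ∧ Irredundant a b := by
  classical
  obtain ⟨hex, -, z, hz⟩ := hP
  -- Take a description with the fewest constraints. By minimality none can be dropped, so each
  -- constraint `j` has a point `p` that violates `j` alone.
  obtain ⟨a, b, hab⟩ := Nat.find_spec hex
  have hmin := fun m => Nat.find_min hex (m := m)
  generalize Nat.find hex = n at a b hab hmin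
  have hviol : ∀ j, ∃ p, b j < inner ℝ (a j) p ∧ ∀ k, k ≠ j → inner ℝ (a k) p ≤ b k := by
    intro j
    obtain _ | m := n
    · exact j.elim0
    by_contra! hno
    refine hmin m (Nat.lt_succ_self m) ⟨a ∘ j.succAbove, b ∘ j.succAbove, ?_⟩
    rw [hab]
    refine Set.Subset.antisymm (fun w hw k => hw _) fun w hw k => ?_
    have hw' : ∀ k, k ≠ j → inner ℝ (a k) w ≤ b k := fun k hk => by
      obtain ⟨l, rfl⟩ := Fin.exists_succAbove_eq hk
      exact hw l
    by_cases hk : k = j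
    · subst hk
      by_contra hlt
      obtain ⟨l, hl, hl'⟩ := hno w (not_le.1 hlt)
      exact (hw' l hl).not_gt hl'
    · exact hw' k hk
  have hzP : z ∈ polyhedron a b := hab ▸ interior_subset hz
  have hzlt : ∀ j, inner ℝ (a j) z < b j := by
    intro j
    refine lt_of_le_of_ne (hzP j) fun heq => ?_
    have h0 : a j ≠ 0 := by
      intro h0
      obtain ⟨p, hp, -⟩ := hviol j
      rw [h0, inner_zero_left] at hp heq
      linarith
    have hc : Filter.Tendsto (fun t : ℝ => z + t • a j) (nhdsWithin 0 (Set.Ioi 0)) (nhds z) := by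
      have : Continuous fun t : ℝ => z + t • a j := by fun_prop
      simpa using (this.tendsto 0).mono_left nhdsWithin_le_nhds
    obtain ⟨t, h1, h2⟩ := ((hc.eventually (mem_interior_iff_mem_nhds.1 hz)).and
      self_mem_nhdsWithin).exists
    have h1' : z + t • a j ∈ polyhedron a b := hab ▸ h1
    have h3 := h1' j
    rw [inner_add_right, real_inner_smul_right, heq] at h3
    have := mul_pos h2 (real_inner_self_pos.2 h0)
    linarith
  refine ⟨n, a, b, hab, ⟨z, hzP, ?_⟩, fun j => ?_⟩
  · exact Set.eq_empty_of_forall_notMem fun j hj => (hzlt j).ne hj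
  · obtain ⟨p, hp, hp'⟩ := hviol j
    have hz1 := hzlt j
    have hpos : 0 < inner ℝ (a j) p - inner ℝ (a j) z := by linarith
    -- The segment from the interior point `z` to `p` crosses the hyperplane `j` at time `s < 1`.
    -- All other constraints are still strict there, being strict at `z`.
    obtain ⟨s, hs⟩ : ∃ s, s = (b j - inner ℝ (a j) z) / (inner ℝ (a j) p - inner ℝ (a j) z) :=
      ⟨_, rfl⟩
    have hs0 : 0 < s := hs ▸ div_pos (by linarith) hpos
    have hs1 : s < 1 := by rw [hs, div_lt_one hpos]; linarith
    have hse : s * (inner ℝ (a j) p - inner ℝ (a j) z) = b j - inner ℝ (a j) z := by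
      rw [hs]; field_simp
    have key : ∀ k, inner ℝ (a k) (z + s • (p - z)) =
        (1 - s) * inner ℝ (a k) z + s * inner ℝ (a k) p := fun k => by
      rw [inner_add_right, real_inner_smul_right, inner_sub_right]; ring
    have hj : inner ℝ (a j) (z + s • (p - z)) = b j := by rw [key]; linarith
    have hk : ∀ k, k ≠ j → inner ℝ (a k) (z + s • (p - z)) < b k := fun k hk => by
      rw [key]
      have h1 := mul_lt_mul_of_pos_left (hzlt k) (sub_pos.2 hs1)
      have h2 := mul_le_mul_of_nonneg_left (hp' k hk) hs0.le
      linarith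
    refine ⟨z + s • (p - z), fun k => ?_, Set.ext fun k => ?_⟩
    · by_cases h : k = j
      · rw [h, hj]
      · exact (hk k h).le
    · rw [mem_act, Set.mem_singleton_iff]
      refine ⟨fun h => ?_, fun h => h ▸ hj⟩
      by_contra hne
      exact (hk k hne).ne h

end Facets

/-- A Dantzig figure is given by an irredundant system of `d + d` constraints, of which the first
`d` are tight at `x` and the last `d` at `y`. -/
theorem Figure.exists_system (D : Figure d) :
    ∃ (a : Fin (d + d) → E d) (b : Fin (d + d) → ℝ), D.P = polyhedron a b ∧ Irredundant a b ∧
      Nondegenerate a b ∧ act a b D.x = Set.range (Fin.castAdd d) ∧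
      act a b D.y = Set.range (Fin.natAdd d) := by
  classical
  obtain ⟨n, a, b, hab, hirr⟩ := exists_irredundant D.simple.1
  have hxP := D.x_mem
  have hyP := D.y_mem
  have hx := D.card_facets_x
  have hn := D.card_facets
  have hy := D.facet_y
  have hs := D.simple
  rw [hab] at hxP hyP hx hn hs
  rw [hirr.ncard_facets] at hn
  rw [hirr.ncard_facets_mem hxP] at hx
  have hb : Bornology.IsBounded (polyhedron a b) := hs.1.2.1
  have hnd := (hirr.isSimple_iff hb).1 hs
  have hcompl : ∀ j, j ∉ act a b D.x ↔ j ∈ act a b D.y := fun j => by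
    have h1 : IsFacet D.P (polyhedron a b ∩ hyperplane (a j) (b j)) :=
      hab ▸ hirr.isFacet_iff.2 ⟨j, rfl⟩
    have := hy _ h1
    simp only [Set.mem_inter_iff, hxP, hyP, true_and] at this
    exact this
  have hx' : Fintype.card {j // j ∈ act a b D.x} = d := by
    rw [← Nat.card_eq_fintype_card, Nat.card_coe_set_eq, hx]
  have hy' : Fintype.card {j // j ∉ act a b D.x} = d := by
    rw [Fintype.card_subtype_compl, hx', Fintype.card_fin]
    omega
  -- Each facet contains exactly one of `x` and `y`, so the constraints can be renumbered with those
  -- at `x` first.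
  let e : Fin (d + d) ≃ Fin n := finSumFinEquiv.symm.trans <|
    (((Fintype.equivFinOfCardEq hx').symm).sumCongr (Fintype.equivFinOfCardEq hy').symm).trans
      (Equiv.sumCompl fun j => j ∈ act a b D.x)
  have e1 : ∀ j, e (Fin.castAdd d j) ∈ act a b D.x := fun j => by
    simp only [e, Equiv.trans_apply, finSumFinEquiv_symm_apply_castAdd, Equiv.sumCongr_apply,
      Sum.map_inl, Equiv.sumCompl_apply_inl]
    exact ((Fintype.equivFinOfCardEq hx').symm j).2
  have e2 : ∀ j, e (Fin.natAdd d j) ∉ act a b D.x := fun j => by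
    simp only [e, Equiv.trans_apply, finSumFinEquiv_symm_apply_natAdd, Equiv.sumCongr_apply,
      Sum.map_inr, Equiv.sumCompl_apply_inr]
    exact ((Fintype.equivFinOfCardEq hy').symm j).2
  have hpoly : polyhedron a b = polyhedron (a ∘ e) (b ∘ e) := by
    ext z
    exact ⟨fun h j => h (e j), fun h j => by simpa using h (e.symm j)⟩
  have hact : ∀ z, act (a ∘ e) (b ∘ e) z = e ⁻¹' act a b z := fun z => rfl
  refine ⟨a ∘ e, b ∘ e, hab.trans hpoly, ⟨?_, fun j => ?_⟩, fun z hz => ?_, ?_, ?_⟩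
  · obtain ⟨z, hz, h⟩ := hirr.slack
    exact ⟨z, hpoly ▸ hz, by rw [hact, h, Set.preimage_empty]⟩
  · obtain ⟨z, hz, h⟩ := hirr.tight (e j)
    refine ⟨z, hpoly ▸ hz, ?_⟩
    rw [hact, h]
    ext k
    simp
  · rw [hact, Set.ncard_preimage_of_injective_subset_range e.injective (by simp)]
    exact hnd z (hpoly ▸ hz)
  · rw [hact]
    ext j
    refine Fin.addCases (fun k => ?_) (fun k => ?_) j
    · simp [e1 k]
    · simp only [Set.mem_preimage, e2 k, false_iff, Set.mem_range, not_exists]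
      intro l hl
      have := congrArg Fin.val hl
      simp at this
      omega
  · rw [hact]
    ext j
    rw [Set.mem_preimage, ← hcompl]
    refine Fin.addCases (fun k => ?_) (fun k => ?_) j
    · simp only [e1 k, not_true_eq_false, false_iff, Set.mem_range, not_exists]
      intro l hl
      have := congrArg Fin.val hl
      simp at this
      omega
    · exact ⟨fun _ => ⟨k, rfl⟩, fun _ => e2 k⟩

/-! ### Standard figures: the non-negative orthant cut by `d` further half-spaces -/

/-- The normals of the constraints `0 ≤ z j` and `⟨M i, z⟩ ≤ 1`. -/
noncomputable def stdNormal (M : Fin d → E d) : Fin (d + d) → E d :=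
  Fin.addCases (fun j => -EuclideanSpace.single j 1) M

/-- The offsets of the constraints `0 ≤ z j` and `⟨M i, z⟩ ≤ 1`. -/
noncomputable def stdOffset (d : ℕ) : Fin (d + d) → ℝ := Fin.addCases (fun _ => 0) fun _ => 1

@[simp]
theorem stdNormal_castAdd (M : Fin d → E d) (j : Fin d) :
    stdNormal M (Fin.castAdd d j) = -EuclideanSpace.single j 1 :=
  Fin.addCases_left _

@[simp]
theorem stdNormal_natAdd (M : Fin d → E d) (i : Fin d) : stdNormal M (Fin.natAdd d i) = M i :=
  Fin.addCases_right _

@[simp]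
theorem stdOffset_castAdd (j : Fin d) : stdOffset d (Fin.castAdd d j) = 0 :=
  Fin.addCases_left _

@[simp]
theorem stdOffset_natAdd (i : Fin d) : stdOffset d (Fin.natAdd d i) = 1 :=
  Fin.addCases_right _

theorem inner_stdNormal_castAdd (M : Fin d → E d) (j : Fin d) (z : E d) :
    inner ℝ (stdNormal M (Fin.castAdd d j)) z = -z j := by
  simp [EuclideanSpace.inner_single_left]

theorem inner_eq_sum (x y : E d) : inner ℝ x y = ∑ j, x j * y j := by
  simp [PiLp.inner_apply, mul_comm]

/-- The polyhedron of all non-negative `z` with `⟨M i, z⟩ ≤ 1`. -/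
abbrev stdPoly (M : Fin d → E d) : Set (E d) := polyhedron (stdNormal M) (stdOffset d)

/-- The tight constraints of the standard system. -/
abbrev stdAct (M : Fin d → E d) (z : E d) : Set (Fin (d + d)) := act (stdNormal M) (stdOffset d) z

theorem mem_stdPoly {M : Fin d → E d} {z : E d} :
    z ∈ stdPoly M ↔ (∀ j, 0 ≤ z j) ∧ ∀ i, inner ℝ (M i) z ≤ 1 := by
  refine ⟨fun h => ⟨fun j => ?_, fun i => ?_⟩, fun h j => Fin.addCases (fun k => ?_) (fun k => ?_) j⟩
  · have := h (Fin.castAdd d j)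
    rw [inner_stdNormal_castAdd, stdOffset_castAdd] at this
    linarith
  · have := h (Fin.natAdd d i)
    rwa [stdNormal_natAdd, stdOffset_natAdd] at this
  · rw [inner_stdNormal_castAdd, stdOffset_castAdd]
    linarith [h.1 k]
  · rw [stdNormal_natAdd, stdOffset_natAdd]
    exact h.2 k

theorem castAdd_mem_stdAct {M : Fin d → E d} {z : E d} {j : Fin d} :
    Fin.castAdd d j ∈ stdAct M z ↔ z j = 0 := by
  rw [mem_act, inner_stdNormal_castAdd, stdOffset_castAdd, neg_eq_zero]

theorem natAdd_mem_stdAct {M : Fin d → E d} {z : E d} {i : Fin d} :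
    Fin.natAdd d i ∈ stdAct M z ↔ inner ℝ (M i) z = 1 := by
  rw [mem_act, stdNormal_natAdd, stdOffset_natAdd]

theorem set_ext_add {S T : Set (Fin (d + d))} (h1 : ∀ j, Fin.castAdd d j ∈ S ↔ Fin.castAdd d j ∈ T)
    (h2 : ∀ i, Fin.natAdd d i ∈ S ↔ Fin.natAdd d i ∈ T) : S = T :=
  Set.ext fun j => Fin.addCases h1 h2 j

theorem castAdd_ne_natAdd (i j : Fin d) : Fin.castAdd d j ≠ Fin.natAdd d i := fun h => by
  have := congrArg Fin.val h
  simp at this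
  omega

theorem castAdd_notMem_range (j : Fin d) :
    Fin.castAdd d j ∉ Set.range (Fin.natAdd d : Fin d → Fin (d + d)) := by
  rintro ⟨i, h⟩
  exact castAdd_ne_natAdd i j h.symm

theorem natAdd_notMem_range (i : Fin d) : Fin.natAdd d i ∉ Set.range (Fin.castAdd (n := d) d) := by
  rintro ⟨j, h⟩
  exact castAdd_ne_natAdd i j h

/-- Conditions on `M` under which the standard system has `d + d` facets, is bounded, and the last
`d` facets meet in a vertex with positive coordinates. -/
structure Good (M : Fin d → E d) : Prop where
  pos : ∀ i j, 0 < M i j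
  inj : ∀ u, (∀ i, inner ℝ (M i) u = 0) → u = 0
  vertex : ∃ y : E d, (∀ j, 0 < y j) ∧ ∀ i, inner ℝ (M i) y = 1

/-- The box of all `z` with `0 ≤ z j ≤ c j`. -/
def box (c : Fin d → ℝ) : Set (E d) := WithLp.toLp 2 '' Set.Icc 0 c

theorem isCompact_box (c : Fin d → ℝ) : IsCompact (box c) :=
  isCompact_Icc.image (PiLp.continuous_toLp 2 _)

/-- The box depends only on lower bounds for the entries, so one compact box serves all systems near
a given one. -/
theorem stdPoly_subset_box {M : Fin d → E d} {c : Fin d → ℝ} (hc : ∀ j, 0 < c j)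
    (h : ∀ i j, (c j)⁻¹ ≤ M i j) : stdPoly M ⊆ box c := by
  intro z hz
  rw [mem_stdPoly] at hz
  refine ⟨z.ofLp, ⟨hz.1, fun j => ?_⟩, rfl⟩
  have h1 := hz.2 j
  rw [inner_eq_sum] at h1
  have h2 : M j j * z j ≤ ∑ k, M j k * z k :=
    Finset.single_le_sum (f := fun k => M j k * z k)
      (fun k _ => mul_nonneg ((inv_pos.2 (hc k)).le.trans (h j k)) (hz.1 k)) (Finset.mem_univ j)
  have h3 := mul_le_mul_of_nonneg_right (h j j) (hz.1 j)
  have h4 : (c j)⁻¹ * z j ≤ 1 := by linarith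
  rwa [inv_mul_le_iff₀ (hc j), mul_one] at h4

theorem exists_box {M : Fin d → E d} (h : ∀ i j, 0 < M i j) :
    ∃ c : Fin d → ℝ, (∀ j, 0 < c j) ∧ ∀ i j, (c j)⁻¹ < M i j := by
  have : ∀ j, ∃ ε > 0, ∀ i, ε < M i j := fun j => by
    obtain ⟨ε, h1, h2⟩ := exists_pos_forall_mem (fun i => M i j) (fun _ => 1) fun i => h i j
    exact ⟨ε, h1, fun i => by simpa using h2 i⟩
  choose ε h1 h2 using this
  exact ⟨fun j => (ε j)⁻¹, fun j => inv_pos.2 (h1 j), fun i j => by simpa using h2 j i⟩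

theorem act_zero (M : Fin d → E d) : stdAct M 0 = Set.range (Fin.castAdd d) := by
  refine set_ext_add (fun j => ?_) fun i => ?_
  · simp [castAdd_mem_stdAct]
  · simp only [natAdd_mem_stdAct, natAdd_notMem_range, inner_zero_right, iff_false]
    exact zero_ne_one

theorem zero_mem_stdPoly (M : Fin d → E d) : 0 ∈ stdPoly M := by simp [mem_stdPoly]

theorem stdAct_eq_of_pos {M : Fin d → E d} {y : E d} (h1 : ∀ j, 0 < y j)
    (h2 : ∀ i, inner ℝ (M i) y = 1) :
    stdAct M y = Set.range (Fin.natAdd d) := by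
  refine set_ext_add (fun j => ?_) fun i => ?_
  · rw [castAdd_mem_stdAct]
    simp only [(h1 j).ne', castAdd_notMem_range]
  · rw [natAdd_mem_stdAct]
    simp only [h2, Set.mem_range_self]

namespace Good

variable {M : Fin d → E d}

theorem isBounded (hM : Good M) : Bornology.IsBounded (stdPoly M) := by
  obtain ⟨c, hc, h⟩ := exists_box hM.pos
  exact (isCompact_box c).isBounded.subset (stdPoly_subset_box hc fun i j => (h i j).le)

theorem linearIndependent (hM : Good M) : LinearIndependent ℝ M := by
  have := linearIndepOn_of_forall_inner (a := M) (J := Set.univ)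
    (fun u hu => hM.inj u fun i => hu i trivial) (by simp [Set.ncard_univ])
  rwa [linearIndepOn_univ_iff] at this

/-- Near the vertex `0` only coordinate constraints can be tight, and moving along a non-negative
`u` keeps just those with `u j = 0`. Near `y` only the last `d` constraints can be tight, and a
direction dual to the independent rows keeps just one of them. -/
theorem irredundant (hM : Good M) : Irredundant (stdNormal M) (stdOffset d) := by
  classical
  have hx : ∀ u : E d, (∀ j, 0 ≤ u j) →
      ∃ z ∈ stdPoly M, stdAct M z = Fin.castAdd d '' {j | u j = 0} := by
    intro u hu
    obtain ⟨ε, -, h1, h2⟩ := exists_pos_add_smul_mem (stdNormal M) (stdOffset d)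
      (zero_mem_stdPoly M) (u := u) fun j hj => by
        have hj' : j ∈ Set.range (Fin.castAdd d) := act_zero M ▸ hj
        obtain ⟨k, rfl⟩ := hj'
        rw [inner_stdNormal_castAdd]
        linarith [hu k]
    refine ⟨_, h1, h2.trans ?_⟩
    change {j ∈ stdAct M 0 | _} = _
    rw [act_zero]
    ext j
    constructor
    · rintro ⟨⟨k, rfl⟩, hk⟩
      rw [inner_stdNormal_castAdd, neg_eq_zero] at hk
      exact ⟨k, hk, rfl⟩
    · rintro ⟨k, hk, rfl⟩
      refine ⟨⟨k, rfl⟩, ?_⟩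
      rw [inner_stdNormal_castAdd, neg_eq_zero]
      exact hk
  refine ⟨?_, fun j => ?_⟩
  · obtain ⟨z, hz, h⟩ := hx (WithLp.toLp 2 fun _ => 1) fun j => by simp
    exact ⟨z, hz, h.trans (by simp)⟩
  · refine Fin.addCases (fun j => ?_) (fun i => ?_) j
    · obtain ⟨z, hz, h⟩ := hx (WithLp.toLp 2 fun k => if k = j then 0 else 1) fun k => by
        simp only; split_ifs <;> norm_num
      exact ⟨z, hz, h.trans (by simp)⟩
    · obtain ⟨y, hy1, hy2⟩ := hM.vertex
      have hact := stdAct_eq_of_pos hy1 hy2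
      have hy : y ∈ stdPoly M := mem_stdPoly.2 ⟨fun j => (hy1 j).le, fun i => (hy2 i).le⟩
      obtain ⟨u, hu⟩ := exists_inner_eq_of_linearIndependent hM.linearIndependent
        fun k => if k = i then 0 else -1
      obtain ⟨ε, -, h1, h2⟩ := exists_pos_add_smul_mem (stdNormal M) (stdOffset d) hy (u := u)
        fun j hj => by
          have hj' : j ∈ Set.range (Fin.natAdd d) := hact ▸ hj
          obtain ⟨k, rfl⟩ := hj'
          rw [stdNormal_natAdd, hu]
          split_ifs <;> norm_num
      refine ⟨_, h1, h2.trans ?_⟩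
      change {j ∈ stdAct M y | _} = _
      rw [hact]
      ext j
      constructor
      · rintro ⟨⟨k, rfl⟩, hk⟩
        rw [stdNormal_natAdd, hu] at hk
        by_contra hne
        have : k ≠ i := fun h => hne (by simp [h])
        simp [this] at hk
      · rintro rfl
        exact ⟨⟨i, rfl⟩, by rw [stdNormal_natAdd, hu]; simp⟩

end Good

theorem zero_mem_extremePoints (M : Fin d → E d) : 0 ∈ (stdPoly M).extremePoints ℝ := by
  refine mem_extremePoints_iff.2 ⟨zero_mem_stdPoly M, fun u hu => ?_⟩
  ext j
  have := hu (Fin.castAdd d j) (by change _ ∈ stdAct M 0; rw [act_zero]; exact ⟨j, rfl⟩)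
  simpa [inner_stdNormal_castAdd, -stdNormal_castAdd] using this

/-- The Dantzig figure of a standard system. -/
noncomputable def stdFigure (M : Fin d → E d) (hM : Good M)
    (hn : Nondegenerate (stdNormal M) (stdOffset d)) : Figure d where
  P := stdPoly M
  x := 0
  y := hM.vertex.choose
  simple := (hM.irredundant.isSimple_iff hM.isBounded).2 hn
  x_vertex := zero_mem_extremePoints M
  y_vertex := by
    have hy := hM.vertex.choose_spec
    refine mem_extremePoints_iff.2
      ⟨mem_stdPoly.2 ⟨fun j => (hy.1 j).le, fun i => (hy.2 i).le⟩, fun u hu => hM.inj u fun i => ?_⟩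
    have := hu (Fin.natAdd d i) (natAdd_mem_stdAct.2 (hy.2 i))
    rwa [stdNormal_natAdd] at this
  card_facets := by rw [hM.irredundant.ncard_facets, two_mul]
  card_facets_x := by
    rw [hM.irredundant.ncard_facets_mem (zero_mem_stdPoly M)]
    change (stdAct M 0).ncard = d
    rw [act_zero, ← Set.image_univ, Set.ncard_image_of_injective _ (Fin.castAdd_injective d d),
      Set.ncard_univ, Nat.card_fin]
  facet_y := by
    intro F hF
    have hy := hM.vertex.choose_spec
    have hyP : hM.vertex.choose ∈ stdPoly M :=
      mem_stdPoly.2 ⟨fun j => (hy.1 j).le, fun i => (hy.2 i).le⟩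
    obtain ⟨j, rfl⟩ := hM.irredundant.isFacet_iff.1 hF
    have h1 : ∀ z, z ∈ hyperplane (stdNormal M j) (stdOffset d j) ↔ j ∈ stdAct M z := fun _ => Iff.rfl
    simp only [Set.mem_inter_iff, zero_mem_stdPoly, hyP, true_and, h1, act_zero,
      stdAct_eq_of_pos hy.1 hy.2]
    refine Fin.addCases (fun k => ?_) (fun k => ?_) j
    · simp only [castAdd_notMem_range, Set.mem_range_self, not_true_eq_false]
    · simp only [natAdd_notMem_range, Set.mem_range_self, not_false_eq_true]

/-! ### Openness -/

theorem continuous_stdNormal (j : Fin (d + d)) : Continuous fun M : Fin d → E d => stdNormal M j := by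
  refine Fin.addCases (fun k => ?_) (fun k => ?_) j
  · simp only [stdNormal_castAdd]
    exact continuous_const
  · simp only [stdNormal_natAdd]
    exact continuous_apply k

theorem eventually_stdPoly_subset_box {M : Fin d → E d} (hM : ∀ i j, 0 < M i j) :
    ∃ c : Fin d → ℝ, ∀ᶠ M' in nhds M, stdPoly M' ⊆ box c := by
  obtain ⟨c, hc, h⟩ := exists_box hM
  have : ∀ᶠ M' in nhds M, ∀ i j, (c j)⁻¹ < M' i j := by
    refine Filter.eventually_all.2 fun i => Filter.eventually_all.2 fun j => ?_
    have : Continuous fun M' : Fin d → E d => M' i j := by fun_prop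
    exact this.continuousAt.eventually (lt_mem_nhds (h i j))
  exact ⟨c, this.mono fun M' h' => stdPoly_subset_box hc fun i j => (h' i j).le⟩

/-- No new tight set appears near `M`: having all of `J` tight is a closed condition on the system
and the point. By compactness of the box, sets occurring arbitrarily close to `M` are contained in a
tight set at `M`, hence are themselves tight sets by nondegeneracy. -/
theorem eventually_activeSets_subset {M : Fin d → E d} (hM : Good M)
    (hn : Nondegenerate (stdNormal M) (stdOffset d)) : ∀ᶠ M' in nhds M,
    activeSets (stdNormal M') (stdOffset d) ⊆ activeSets (stdNormal M) (stdOffset d) := by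
  obtain ⟨c, hc⟩ := eventually_stdPoly_subset_box hM.pos
  have h1 : ∀ J : Set (Fin (d + d)), ∀ᶠ M' in nhds M,
      J ∉ activeSets (stdNormal M) (stdOffset d) →
        ∀ z ∈ box c, ¬ (z ∈ stdPoly M' ∧ J ⊆ stdAct M' z) := by
    intro J
    by_cases hJ : J ∈ activeSets (stdNormal M) (stdOffset d)
    · simp [hJ]
    simp only [hJ, not_false_eq_true, forall_true_left]
    refine (isCompact_box c).eventually_forall_of_forall_eventually fun z _ => ?_
    have hclosed : IsClosed {p : (Fin d → E d) × E d | p.2 ∈ stdPoly p.1 ∧ J ⊆ stdAct p.1 p.2} := by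
      have hcont : ∀ j, Continuous fun p : (Fin d → E d) × E d =>
          inner ℝ (stdNormal p.1 j) p.2 := fun j =>
        ((continuous_stdNormal j).comp continuous_fst).inner continuous_snd
      have : {p : (Fin d → E d) × E d | p.2 ∈ stdPoly p.1 ∧ J ⊆ stdAct p.1 p.2} =
          (⋂ j, {p | inner ℝ (stdNormal p.1 j) p.2 ≤ stdOffset d j}) ∩
            ⋂ j ∈ J, {p | inner ℝ (stdNormal p.1 j) p.2 = stdOffset d j} := by
        ext p
        simp [polyhedron, Set.subset_def, mem_act]
      rw [this]
      exact (isClosed_iInter fun j => isClosed_le (hcont j) continuous_const).inter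
        (isClosed_biInter fun j _ => isClosed_eq (hcont j) continuous_const)
    refine hclosed.isOpen_compl.mem_nhds fun hz => hJ ?_
    exact hn.mem_activeSets_of_subset hM.isBounded hz.1 hz.2
  filter_upwards [hc, Filter.eventually_all.2 h1] with M' h2 h3
  rintro _ ⟨z, hz, rfl⟩
  by_contra hJ
  exact h3 _ hJ z (h2 hz) ⟨hz, subset_rfl⟩

/-- No tight set with independent normals is lost: correct `z` by a combination of vectors `u k`
dual to the normals in `J`. The linear system for the coefficients has matrix `1` at `M`, so
Cramer's rule gives a solution continuous at `M`, and the other constraints stay strict. -/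
theorem eventually_mem_activeSets {M : Fin d → E d} {J : Set (Fin (d + d))} {z : E d}
    (hz : z ∈ stdPoly M) (hJ : stdAct M z = J) (hli : LinearIndepOn ℝ (stdNormal M) J) :
    ∀ᶠ M' in nhds M, J ∈ activeSets (stdNormal M') (stdOffset d) := by
  classical
  have : ∀ k : J, ∃ u, ∀ j : J, inner ℝ (stdNormal M j) u = if j = k then 1 else 0 := fun k =>
    exists_inner_eq_of_linearIndependent hli fun j => if j = k then 1 else 0
  choose u hu using this
  let G : (Fin d → E d) → Matrix J J ℝ := fun M' => Matrix.of fun j k => inner ℝ (stdNormal M' j) (u k)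
  let r : (Fin d → E d) → J → ℝ := fun M' j => stdOffset d j - inner ℝ (stdNormal M' j) z
  let s : (Fin d → E d) → J → ℝ := fun M' => (G M').det⁻¹ • ((G M').adjugate.mulVec (r M'))
  let w : (Fin d → E d) → E d := fun M' => z + ∑ k, s M' k • u k
  have hG : Continuous G := continuous_matrix fun j k =>
    (continuous_stdNormal _).inner continuous_const
  have hr : Continuous r := continuous_pi fun j =>
    continuous_const.sub ((continuous_stdNormal _).inner continuous_const)
  have hG1 : G M = 1 := by
    ext j k
    simp [G, hu, Matrix.one_apply]
  have hr0 : r M = 0 := by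
    ext j
    have : (j : Fin (d + d)) ∈ stdAct M z := hJ ▸ j.2
    simp [r, mem_act.1 this]
  have hs : ContinuousAt s M := by
    have h1 : ContinuousAt (fun M' => (G M').det⁻¹) M := by
      refine ContinuousAt.inv₀ hG.matrix_det.continuousAt ?_
      simp [hG1]
    exact h1.smul (hG.matrix_adjugate.matrix_mulVec hr).continuousAt
  have hs0 : s M = 0 := by simp [s, hr0]
  have hw : ContinuousAt w M := by
    refine continuousAt_const.add (tendsto_finsetSum _ fun k _ => ?_)
    exact ((continuous_apply k).continuousAt.comp hs).smul continuousAt_const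
  have hw0 : w M = z := by simp [w, hs0]
  have hdet : ∀ᶠ M' in nhds M, (G M').det ≠ 0 :=
    hG.matrix_det.continuousAt.eventually_ne (by simp [hG1])
  have hlt : ∀ᶠ M' in nhds M, ∀ j, j ∉ J → inner ℝ (stdNormal M' j) (w M') < stdOffset d j := by
    refine Filter.eventually_all.2 fun j => ?_
    by_cases hj : j ∈ J
    · simp [hj]
    have h1 : ContinuousAt (fun M' => inner ℝ (stdNormal M' j) (w M')) M :=
      (continuous_stdNormal j).continuousAt.inner hw
    have h2 : inner ℝ (stdNormal M j) (w M) < stdOffset d j := by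
      rw [hw0]
      exact lt_of_notMem_act hz fun h => hj (hJ ▸ h)
    exact (h1.eventually_lt_const h2).mono fun _ h _ => h
  filter_upwards [hdet, hlt] with M' h1 h2
  have h3 : ∀ j ∈ J, inner ℝ (stdNormal M' j) (w M') = stdOffset d j := by
    intro j hj
    have h4 : (G M').mulVec (s M') = r M' := by
      simp only [s]
      rw [Matrix.mulVec_smul, Matrix.mulVec_mulVec, Matrix.mul_adjugate, Matrix.smul_mulVec,
        Matrix.one_mulVec, smul_smul, inv_mul_cancel₀ h1, one_smul]
    have h5 := congrFun h4 ⟨j, hj⟩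
    simp only [Matrix.mulVec, dotProduct, G, Matrix.of_apply, r] at h5
    simp only [w, inner_add_right, inner_sum, real_inner_smul_right]
    have h6 : ∑ k, s M' k * inner ℝ (stdNormal M' j) (u k) =
        ∑ k, inner ℝ (stdNormal M' j) (u k) * s M' k :=
      Finset.sum_congr rfl fun k _ => mul_comm _ _
    rw [h6, h5]
    ring
  refine ⟨w M', fun j => ?_, Set.ext fun j => ?_⟩
  · by_cases hj : j ∈ J
    · exact (h3 j hj).le
    · exact (h2 j hj).le
  · exact ⟨fun h => by_contra fun hj => (h2 j hj).ne h, fun hj => h3 j hj⟩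

/-- The combinatorial type of a nondegenerate standard system is locally constant. -/
theorem eventually_activeSets_eq {M : Fin d → E d} (hM : Good M)
    (hn : Nondegenerate (stdNormal M) (stdOffset d)) : ∀ᶠ M' in nhds M,
    activeSets (stdNormal M') (stdOffset d) = activeSets (stdNormal M) (stdOffset d) := by
  have h1 : ∀ᶠ M' in nhds M, ∀ J, J ∈ activeSets (stdNormal M) (stdOffset d) →
      J ∈ activeSets (stdNormal M') (stdOffset d) := by
    refine Filter.eventually_all.2 fun J => ?_
    by_cases hJ : J ∈ activeSets (stdNormal M) (stdOffset d)
    · obtain ⟨z, hz, e⟩ := hJ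
      exact (eventually_mem_activeSets hz e (e ▸ hn.linearIndepOn hM.isBounded hz)).mono fun _ h _ => h
    · simp [hJ]
  filter_upwards [h1, eventually_activeSets_subset hM hn] with M' h h'
  exact Set.Subset.antisymm h' h

theorem nondegenerate_iff_activeSets {n : ℕ} {a : Fin n → E d} {b : Fin n → ℝ} :
    Nondegenerate a b ↔ ∀ J ∈ activeSets a b, J.ncard ≤ d := by
  simp [Nondegenerate, activeSets]

/-- Goodness means positive entries, non-zero determinant and a positive solution `y` of `M y = 1`.
By Cramer's rule `y` varies continuously where the determinant is non-zero. -/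
theorem isOpen_good : IsOpen {M : Fin d → E d | Good M} := by
  classical
  let A : (Fin d → E d) → Matrix (Fin d) (Fin d) ℝ := fun M => Matrix.of fun i j => M i j
  have hA : Continuous A := continuous_matrix fun i j => by
    simp only [A, Matrix.of_apply]; fun_prop
  have hinner : ∀ M i (z : E d), inner ℝ (M i) z = (A M).mulVec z.ofLp i := fun M i z => by
    rw [inner_eq_sum]; rfl
  let y : (Fin d → E d) → Fin d → ℝ := fun M => (A M).det⁻¹ • ((A M).adjugate.mulVec 1)
  have hAy : ∀ M, (A M).det ≠ 0 → (A M).mulVec (y M) = 1 := fun M h => by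
    simp only [y]
    rw [Matrix.mulVec_smul, Matrix.mulVec_mulVec, Matrix.mul_adjugate, Matrix.smul_mulVec,
      Matrix.one_mulVec, smul_smul, inv_mul_cancel₀ h, one_smul]
  have hgood : ∀ M, Good M ↔ (∀ i j, 0 < M i j) ∧ (A M).det ≠ 0 ∧ ∀ j, 0 < y M j := by
    intro M
    have hdet : (A M).det ≠ 0 ↔ ∀ u : E d, (∀ i, inner ℝ (M i) u = 0) → u = 0 := by
      rw [← not_iff_not, not_not, ← Matrix.exists_mulVec_eq_zero_iff]
      push Not
      constructor
      · rintro ⟨v, hv, h⟩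
        refine ⟨WithLp.toLp 2 v, fun i => ?_, fun h0 => hv ?_⟩
        · rw [hinner]; exact congrFun h i
        · simpa using congrArg WithLp.ofLp h0
      · rintro ⟨u, h, hu⟩
        refine ⟨u.ofLp, fun h0 => hu ?_, funext fun i => ?_⟩
        · ext j; exact congrFun h0 j
        · rw [← hinner, h]; rfl
    constructor
    · intro h
      have hd := hdet.2 h.inj
      obtain ⟨z, hz, hz'⟩ := h.vertex
      refine ⟨h.pos, hd, fun j => ?_⟩
      have : z - WithLp.toLp 2 (y M) = 0 := h.inj _ fun i => by
        rw [inner_sub_right, hz', hinner, hAy M hd]; simp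
      rw [sub_eq_zero] at this
      have := hz j
      simp_all
    · rintro ⟨h1, h2, h3⟩
      refine ⟨h1, hdet.1 h2, WithLp.toLp 2 (y M), h3, fun i => ?_⟩
      rw [hinner, hAy M h2]; rfl
  rw [isOpen_iff_eventually]
  intro M hM
  obtain ⟨h1, h2, h3⟩ := (hgood M).1 hM
  have hy : ContinuousAt y M := (hA.matrix_det.continuousAt.inv₀ h2).smul
    (hA.matrix_adjugate.matrix_mulVec continuous_const).continuousAt
  have e1 : ∀ᶠ M' in nhds M, ∀ i j, 0 < M' i j :=
    Filter.eventually_all.2 fun i => Filter.eventually_all.2 fun j =>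
      (by fun_prop : Continuous fun M' : Fin d → E d => M' i j).continuousAt.eventually
        (lt_mem_nhds (h1 i j))
  have e2 : ∀ᶠ M' in nhds M, (A M').det ≠ 0 := hA.matrix_det.continuousAt.eventually_ne h2
  have e3 : ∀ᶠ M' in nhds M, ∀ j, 0 < y M' j := Filter.eventually_all.2 fun j =>
    ((continuous_apply j).continuousAt.comp hy).eventually (lt_mem_nhds (h3 j))
  filter_upwards [e1, e2, e3] with M' h1 h2 h3
  exact (hgood M').2 ⟨h1, h2, h3⟩

/-! ### Moving one row -/

/-- The elementary steps: fundamental deformations, and simple moves together with the fact that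
they preserve the combinatorial type. -/
def Step (D D' : Figure d) : Prop :=
  FundamentalDeformation D D' ∨ (SimpleMove D D' ∧ SameType D D')

/-- The rows obtained by moving the row `i` in the direction `w` for the time `t`. -/
noncomputable def rowMove (M : Fin d → E d) (i : Fin d) (w : E d) (t : ℝ) : Fin d → E d :=
  Function.update M i (M i + t • w)

section RowMove

variable {M : Fin d → E d} {i : Fin d} {w : E d}

@[simp]
theorem rowMove_zero (M : Fin d → E d) (i : Fin d) (w : E d) : rowMove M i w 0 = M := by
  simp [rowMove]

theorem rowMove_self (t : ℝ) : rowMove M i w t i = M i + t • w := by simp [rowMove]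

theorem rowMove_of_ne {k : Fin d} (hk : k ≠ i) (t : ℝ) : rowMove M i w t k = M k := by
  simp [rowMove, hk]

theorem rowMove_rowMove (s r t : ℝ) :
    rowMove (rowMove M i w s) i (r • w) t = rowMove M i w (s + t * r) := by
  simp only [rowMove, Function.update_self, Function.update_idem]
  congr 1
  module

theorem continuous_rowMove (M : Fin d → E d) (i : Fin d) (w : E d) :
    Continuous (rowMove M i w) :=
  continuous_const.update i (by fun_prop)

theorem inner_nonneg_of_pos (hw : ∀ j, 0 < w j) {z : E d} (hz : ∀ j, 0 ≤ z j) :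
    0 ≤ inner ℝ w z := by
  rw [inner_eq_sum]
  exact Finset.sum_nonneg fun j _ => mul_nonneg (hw j).le (hz j)

theorem eq_zero_of_inner_eq_zero (hw : ∀ j, 0 < w j) {z : E d} (hz : ∀ j, 0 ≤ z j)
    (h : inner ℝ w z = 0) : z = 0 := by
  rw [inner_eq_sum, Finset.sum_eq_zero_iff_of_nonneg
    fun j _ => mul_nonneg (hw j).le (hz j)] at h
  ext j
  exact (mul_eq_zero.1 (h j (Finset.mem_univ j))).resolve_left (hw j).ne'

theorem stdPoly_rowMove_anti (hw : ∀ j, 0 < w j) {s t : ℝ} (hst : s ≤ t) :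
    stdPoly (rowMove M i w t) ⊆ stdPoly (rowMove M i w s) := by
  intro z hz
  rw [mem_stdPoly] at hz ⊢
  refine ⟨hz.1, fun k => ?_⟩
  by_cases hk : k = i
  · subst hk
    have h1 := hz.2 k
    have h2 := mul_nonneg (sub_nonneg.2 hst) (inner_nonneg_of_pos hw hz.1)
    rw [rowMove_self, inner_add_left, real_inner_smul_left] at h1 ⊢
    linarith
  · have h1 := hz.2 k
    rwa [rowMove_of_ne hk] at h1 ⊢

theorem stdPoly_rowMove_subset (hw : ∀ j, 0 < w j) {t : ℝ} (ht : 0 ≤ t) :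
    stdPoly (rowMove M i w t) ⊆ stdPoly M := by
  simpa using stdPoly_rowMove_anti (M := M) (i := i) hw ht

theorem mem_act_rowMove_iff {k : Fin (d + d)} (hk : k ≠ Fin.natAdd d i) {t : ℝ} {z : E d} :
    k ∈ stdAct (rowMove M i w t) z ↔ k ∈ stdAct M z := by
  induction k using Fin.addCases with
  | left k => rw [castAdd_mem_stdAct, castAdd_mem_stdAct]
  | right k =>
    rw [natAdd_mem_stdAct, natAdd_mem_stdAct, rowMove_of_ne fun h => hk (by rw [h])]

theorem natAdd_mem_act_rowMove {t : ℝ} {z : E d} :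
    Fin.natAdd d i ∈ stdAct (rowMove M i w t) z ↔ inner ℝ (M i) z + t * inner ℝ w z = 1 := by
  rw [natAdd_mem_stdAct, rowMove_self, inner_add_left, real_inner_smul_left]

/-- The moved facet leaves the old one behind. -/
theorem natAdd_notMem_act (hw : ∀ j, 0 < w j) {t : ℝ} (ht : 0 < t) {z : E d}
    (hz : z ∈ stdPoly (rowMove M i w t)) : Fin.natAdd d i ∉ stdAct M z := by
  intro h
  rw [natAdd_mem_stdAct] at h
  rw [mem_stdPoly] at hz
  have h1 := hz.2 i
  rw [rowMove_self, inner_add_left, real_inner_smul_left, h] at h1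
  have h2 := inner_nonneg_of_pos hw hz.1
  have h3 : inner ℝ w z = 0 := by nlinarith
  rw [eq_zero_of_inner_eq_zero hw hz.1 h3, inner_zero_right] at h
  exact zero_ne_one h

/-- The vertices that do not lie on the facet `i`. -/
def fixedVertices (M : Fin d → E d) (i : Fin d) : Set (E d) :=
  {v ∈ (stdPoly M).extremePoints ℝ | Fin.natAdd d i ∉ stdAct M v}

theorem act_injOn_extremePoints {n : ℕ} {a : Fin n → E d} {b : Fin n → ℝ} :
    Set.InjOn (act a b) ((polyhedron a b).extremePoints ℝ) := by
  intro v hv u _ h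
  refine sub_eq_zero.1 ((mem_extremePoints_iff.1 hv).2 _ fun j hj => ?_)
  have hj' : j ∈ act a b u := h ▸ hj
  rw [inner_sub_right, mem_act.1 hj, mem_act.1 hj', sub_self]

theorem finite_fixedVertices (M : Fin d → E d) (i : Fin d) : (fixedVertices M i).Finite :=
  (Set.Finite.of_finite_image (Set.toFinite _) (act_injOn_extremePoints)).subset fun _ h => h.1

/-- At a vertex of the moved polytope the old hyperplane `i` is no longer tight. More than `d` tight
constraints therefore means `d` fixed ones together with the moved one, and those `d` already make
the point a vertex of the original polytope. -/
theorem exists_fixedVertex_of_not_nondegenerate (hM : Good M)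
    (hn : Nondegenerate (stdNormal M) (stdOffset d)) (hw : ∀ j, 0 < w j) {t : ℝ} (ht : 0 < t)
    (hg : Good (rowMove M i w t))
    (hnt : ¬ Nondegenerate (stdNormal (rowMove M i w t)) (stdOffset d)) :
    ∃ v ∈ fixedVertices M i, inner ℝ (M i) v + t * inner ℝ w v = 1 := by
  by_contra! hno
  refine hnt (nondegenerate_of_extremePoints hg.isBounded fun v hv => ?_)
  rw [mem_extremePoints_iff] at hv
  have hv0 : v ∈ stdPoly M := stdPoly_rowMove_subset hw ht.le hv.1
  have hi := natAdd_notMem_act hw ht hv.1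
  have hsub : stdAct (rowMove M i w t) v ⊆ insert (Fin.natAdd d i) (stdAct M v) := fun k hk => by
    by_cases hki : k = Fin.natAdd d i
    · exact Or.inl hki
    · exact Or.inr ((mem_act_rowMove_iff hki).1 hk)
  by_cases hit : Fin.natAdd d i ∈ stdAct (rowMove M i w t) v
  · have hlt : (stdAct M v).ncard < d := by
      refine lt_of_le_of_ne (hn v hv0) fun heq => ?_
      refine hno v ⟨mem_extremePoints_iff.2 ⟨hv0, fun u hu => ?_⟩, hi⟩ (natAdd_mem_act_rowMove.1 hit)
      exact forall_inner_of_linearIndepOn (hn.linearIndepOn hM.isBounded hv0) heq u hu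
    exact (Set.ncard_le_ncard hsub).trans ((Set.ncard_insert_le _ _).trans hlt)
  · refine (Set.ncard_le_ncard (fun k hk => ?_)).trans (hn v hv0)
    exact (hsub hk).resolve_left fun h => hit (h ▸ hk)

theorem mem_stdPoly_of_hit {t : ℝ} {v : E d}
    (hv : v ∈ fixedVertices M i) (h : inner ℝ (M i) v + t * inner ℝ w v = 1) :
    v ∈ stdPoly (rowMove M i w t) := by
  have hv0 := mem_stdPoly.1 hv.1.1
  refine mem_stdPoly.2 ⟨hv0.1, fun k => ?_⟩
  by_cases hk : k = i
  · rw [hk, rowMove_self, inner_add_left, real_inner_smul_left, h]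
  · rw [rowMove_of_ne hk]
    exact hv0.2 k

theorem not_nondegenerate_of_hit {t : ℝ} {v : E d}
    (hv : v ∈ fixedVertices M i) (h : inner ℝ (M i) v + t * inner ℝ w v = 1) :
    ¬ Nondegenerate (stdNormal (rowMove M i w t)) (stdOffset d) := by
  intro hn
  have h1 := hn v (mem_stdPoly_of_hit hv h)
  have h2 : insert (Fin.natAdd d i) (stdAct M v) ⊆ stdAct (rowMove M i w t) v := by
    rintro k (rfl | hk)
    · exact natAdd_mem_act_rowMove.2 h
    · exact (mem_act_rowMove_iff fun e => hv.2 (e ▸ hk)).2 hk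
  have h3 := le_ncard_of_forall_inner (mem_extremePoints_iff.1 hv.1).2
  have h4 := Set.ncard_le_ncard h2
  rw [Set.ncard_insert_of_notMem hv.2] at h4
  change (stdAct (rowMove M i w t) v).ncard ≤ d at h1
  change d ≤ (stdAct M v).ncard at h3
  omega

theorem inner_pos_of_hit (hw : ∀ j, 0 < w j) {t : ℝ} {v : E d}
    (hv : v ∈ fixedVertices M i) (h : inner ℝ (M i) v + t * inner ℝ w v = 1) :
    0 < inner ℝ w v := by
  have hv0 := mem_stdPoly.1 hv.1.1
  refine lt_of_le_of_ne (inner_nonneg_of_pos hw hv0.1) fun h0 => ?_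
  rw [eq_zero_of_inner_eq_zero hw hv0.1 h0.symm] at h
  simp at h

/-- If constraint `i` is tight at `v`, independence gives a direction that changes it and no other
tight constraint. The fixed hyperplanes through `v` then contain a whole line. -/
theorem isFixedVertex_iff (hM : Good M) (hn : Nondegenerate (stdNormal M) (stdOffset d))
    {v : E d} : IsFixedVertex (Fin.natAdd d i) (fun t => stdNormal (rowMove M i w t))
      (fun _ => stdOffset d) v ↔ v ∈ fixedVertices M i := by
  classical
  simp only [IsFixedVertex, rowMove_zero]
  constructor
  · rintro ⟨hv, J, hJ, h⟩
    refine ⟨hv, fun hi => ?_⟩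
    have hJv : ∀ j ∈ J, j ∈ stdAct M v := by
      have : v ∈ ({v} : Set (E d)) := rfl
      rw [← h] at this
      exact this
    obtain ⟨u, hu⟩ := exists_inner_eq_of_linearIndependent (hn.linearIndepOn hM.isBounded hv.1)
      fun j => if (j : Fin (d + d)) = Fin.natAdd d i then 1 else 0
    have h1 : v + u ∈ ({v} : Set (E d)) := by
      rw [← h]
      intro j hj
      have := hu ⟨j, hJv j hj⟩
      have hne : j ≠ Fin.natAdd d i := fun e => hJ (e ▸ hj)
      simp only [hne, if_false] at this
      change inner ℝ _ _ = _
      rw [inner_add_right, this, add_zero]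
      exact hJv j hj
    have h2 : u = 0 := by simpa using h1
    have := hu ⟨_, hi⟩
    simp [h2] at this
  · rintro ⟨hv, hi⟩
    refine ⟨hv, (stdAct M v).toFinset, by simpa using hi, ?_⟩
    ext z
    simp only [Set.mem_toFinset, Set.mem_ofPred_eq, Set.mem_singleton_iff]
    constructor
    · intro hz
      refine sub_eq_zero.1 ((mem_extremePoints_iff.1 hv).2 _ fun j hj => ?_)
      have h1 : inner ℝ (stdNormal M j) z = stdOffset d j := hz j hj
      rw [inner_sub_right, h1, mem_act.1 hj, sub_self]
    · rintro rfl j hj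
      exact hj

theorem isMove_rowMove (hw : ∀ j, 0 < w j)
    (hg : ∀ t ∈ Set.Icc (0 : ℝ) 1, Good (rowMove M i w t)) :
    IsMove (Fin.natAdd d i) (fun t => stdNormal (rowMove M i w t)) (fun _ => stdOffset d) where
  continuous_normal :=
    ((continuous_stdNormal _).comp (continuous_rowMove M i w)).continuousOn
  continuous_offset := continuousOn_const
  fixed t _ j hj := by
    refine ⟨?_, rfl⟩
    induction j using Fin.addCases with
    | left k => simp only [stdNormal_castAdd]
    | right k =>
      have hk : k ≠ i := fun h => hj (by rw [h])
      simp only [stdNormal_natAdd, rowMove_of_ne hk]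
  polytope t ht := (hg t ht).irredundant.isPolytope (hg t ht).isBounded
  facets t ht _ := (hg t ht).irredundant.isFacet_iff
  facets_injective t ht := (hg t ht).irredundant.facet_injective
  decreasing _ _ _ _ hst := stdPoly_rowMove_anti hw hst.le

theorem joins_stdFigure {n : ℕ} {a : ℝ → Fin n → E d} {b : ℝ → Fin n → ℝ} {D D' : Figure d}
    (h0 : D.P = polyhedron (a 0) (b 0)) (h1 : D'.P = polyhedron (a 1) (b 1))
    (hx : act (a 0) (b 0) D.x = act (a 1) (b 1) D'.x)
    (hy : act (a 0) (b 0) D.y = act (a 1) (b 1) D'.y) : Joins a b D D' :=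
  ⟨h0, h1, fun j => Set.ext_iff.1 hx j, fun j => Set.ext_iff.1 hy j⟩

theorem stdAct_x (hM : Good M) (hn : Nondegenerate (stdNormal M) (stdOffset d)) :
    stdAct M (stdFigure M hM hn).x = Set.range (Fin.castAdd d) := act_zero M

theorem stdAct_y (hM : Good M) (hn : Nondegenerate (stdNormal M) (stdOffset d)) :
    stdAct M (stdFigure M hM hn).y = Set.range (Fin.natAdd d) :=
  stdAct_eq_of_pos hM.vertex.choose_spec.1 hM.vertex.choose_spec.2

theorem joins_rowMove {N : Fin d → E d} (hN : N = rowMove M i w 1) (hM : Good M)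
    (hn : Nondegenerate (stdNormal M) (stdOffset d)) (hM' : Good N)
    (hn' : Nondegenerate (stdNormal N) (stdOffset d)) :
    Joins (fun t => stdNormal (rowMove M i w t)) (fun _ => stdOffset d)
      (stdFigure M hM hn) (stdFigure N hM' hn') := by
  subst hN
  refine joins_stdFigure ?_ rfl ?_ ?_
  · simp only [rowMove_zero]; rfl
  · simp only [rowMove_zero]
    exact (stdAct_x hM hn).trans (stdAct_x hM' hn').symm
  · simp only [rowMove_zero]
    exact (stdAct_y hM hn).trans (stdAct_y hM' hn').symm

/-- Vanishing edges never contain a distinguished vertex that stays on its facets. -/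
theorem not_mem_of_isVanishingEdge {n : ℕ} {a : ℝ → Fin n → E d} {b : ℝ → Fin n → ℝ}
    {D D' : Figure d} (h : Joins a b D D') {e : Set (E d)} (he : IsVanishingEdge a b e) :
    D.x ∉ e ∧ D.y ∉ e := by
  obtain ⟨-, J, rfl, hJ⟩ := he
  have hx' := D'.x_mem
  have hy' := D'.y_mem
  rw [h.2.1] at hx' hy'
  refine ⟨fun hx => ?_, fun hy => ?_⟩
  · exact Set.eq_empty_iff_forall_notMem.1 hJ D'.x
      ⟨hx', fun j hj => (h.2.2.1 j).1 (hx.2 j hj)⟩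
  · exact Set.eq_empty_iff_forall_notMem.1 hJ D'.y
      ⟨hy', fun j hj => (h.2.2.2 j).1 (hy.2 j hj)⟩

theorem step_of_unique_hit {N : Fin d → E d} (hN : N = rowMove M i w 1) (hM : Good M)
    (hn : Nondegenerate (stdNormal M) (stdOffset d)) (hM' : Good N)
    (hn' : Nondegenerate (stdNormal N) (stdOffset d)) (hw : ∀ j, 0 < w j)
    (hg : ∀ t ∈ Set.Icc (0 : ℝ) 1, Good (rowMove M i w t)) {t₀ : ℝ} (ht₀ : t₀ ∈ Set.Ioo (0 : ℝ) 1)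
    (hn₀ : ¬ Nondegenerate (stdNormal (rowMove M i w t₀)) (stdOffset d))
    (hnt : ∀ t ∈ Set.Icc (0 : ℝ) 1, t ≠ t₀ →
      Nondegenerate (stdNormal (rowMove M i w t)) (stdOffset d))
    (huniq : ∀ u ∈ fixedVertices M i, ∀ v ∈ fixedVertices M i,
      inner ℝ (M i) u + t₀ * inner ℝ w u = 1 → inner ℝ (M i) v + t₀ * inner ℝ w v = 1 → u = v) :
    FundamentalDeformation (stdFigure M hM hn) (stdFigure N hM' hn') := by
  have hsimple : ∀ t ∈ Set.Icc (0 : ℝ) 1, IsSimple (stdPoly (rowMove M i w t)) ↔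
      Nondegenerate (stdNormal (rowMove M i w t)) (stdOffset d) := fun t ht =>
    (hg t ht).irredundant.isSimple_iff (hg t ht).isBounded
  have hmem : t₀ ∈ Set.Icc (0 : ℝ) 1 := ⟨ht₀.1.le, ht₀.2.le⟩
  have hjoin := joins_rowMove hN hM hn hM' hn'
  have hhyp : ∀ t u, u ∈ hyperplane (stdNormal (rowMove M i w t) (Fin.natAdd d i))
      (stdOffset d (Fin.natAdd d i)) ↔ inner ℝ (M i) u + t * inner ℝ w u = 1 := fun t u =>
    natAdd_mem_act_rowMove
  refine ⟨_, _, _, _, ⟨isMove_rowMove hw hg, t₀, ⟨ht₀.1.le, ht₀.2⟩, ?_, fun t ht hne => ?_, ?_⟩,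
    hjoin, fun e he => not_mem_of_isVanishingEdge hjoin he⟩
  · exact fun h => hn₀ ((hsimple t₀ hmem).1 h)
  · exact (hsimple t ht).2 (hnt t ht hne)
  · obtain ⟨v, hv, hv1⟩ := exists_fixedVertex_of_not_nondegenerate hM hn hw ht₀.1 (hg t₀ hmem) hn₀
    refine ⟨v, (isFixedVertex_iff hM hn).2 hv, (hhyp _ _).2 hv1, fun t ht hvt => ?_,
      fun u hu ⟨t, ht, hut⟩ => ?_⟩
    · have h1 := (mem_stdPoly.1 hvt).2 i
      rw [rowMove_self, inner_add_left, real_inner_smul_left] at h1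
      have h2 := mul_pos (sub_pos.2 ht.1) (inner_pos_of_hit hw hv hv1)
      linarith
    · rw [isFixedVertex_iff hM hn] at hu
      rw [hhyp] at hut
      -- A fixed vertex hit at time `t` destroys nondegeneracy at that time, which happens only at
      -- `t₀`.
      have : t = t₀ := by
        by_contra hne
        exact not_nondegenerate_of_hit hu hut (hnt t ht hne)
      subst this
      exact huniq u hu v hv hut hv1

theorem step_of_nondegenerate {N : Fin d → E d} (hN : N = rowMove M i w 1) (hM : Good M)
    (hn : Nondegenerate (stdNormal M) (stdOffset d)) (hM' : Good N)
    (hn' : Nondegenerate (stdNormal N) (stdOffset d)) (hw : ∀ j, 0 < w j)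
    (hg : ∀ t ∈ Set.Icc (0 : ℝ) 1, Good (rowMove M i w t))
    (hnt : ∀ t ∈ Set.Icc (0 : ℝ) 1,
      Nondegenerate (stdNormal (rowMove M i w t)) (stdOffset d)) :
    SimpleMove (stdFigure M hM hn) (stdFigure N hM' hn') ∧
      SameType (stdFigure M hM hn) (stdFigure N hM' hn') := by
  refine ⟨⟨_, _, _, _, ⟨isMove_rowMove hw hg, fun t ht => ?_⟩, joins_rowMove hN hM hn hM' hn'⟩, ?_⟩
  · exact ((hg t ht).irredundant.isSimple_iff (hg t ht).isBounded).2 (hnt t ht)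
  · let f : Set.Icc (0 : ℝ) 1 → Set (Set (Fin (d + d))) := fun t =>
      activeSets (stdNormal (rowMove M i w t)) (stdOffset d)
    -- The family of tight sets is locally constant on the connected interval, so both ends have the
    -- same type.
    have hf : IsLocallyConstant f := (IsLocallyConstant.iff_eventually_eq f).2 fun t =>
      ((continuous_rowMove M i w).comp continuous_subtype_val).continuousAt.eventually
        (eventually_activeSets_eq (hg t t.2) (hnt t t.2))
    have h01 := hf.apply_eq_of_preconnectedSpace ⟨0, by simp⟩ ⟨1, by simp⟩
    simp only [f, rowMove_zero] at h01
    refine sameType_of_activeSets_eq (a := stdNormal M) (b := stdOffset d) (a' := stdNormal N)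
      (b' := stdOffset d) rfl rfl (hN ▸ h01) ?_ ?_
    · exact (stdAct_x hM hn).trans (stdAct_x hM' hn').symm
    · exact (stdAct_y hM hn).trans (stdAct_y hM' hn').symm

/-- Genericity of `w` with respect to the initial fixed vertices thereby persists when the move is
restarted at a later time. -/
theorem fixedVertices_rowMove_subset (hw : ∀ j, 0 < w j) {s : ℝ} (hs : 0 ≤ s) :
    fixedVertices (rowMove M i w s) i ⊆ fixedVertices M i := by
  rcases hs.eq_or_lt with rfl | hs
  · rw [rowMove_zero]
  rintro v ⟨hv, hi⟩
  have h0 := natAdd_notMem_act hw hs hv.1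
  rw [mem_extremePoints_iff] at hv
  refine ⟨mem_extremePoints_iff.2 ⟨stdPoly_rowMove_subset hw hs.le hv.1, fun u hu => ?_⟩, h0⟩
  refine hv.2 u fun j hj => ?_
  have hne : j ≠ Fin.natAdd d i := fun e => hi (e ▸ hj)
  have h1 := hu j ((mem_act_rowMove_iff hne).1 hj)
  induction j using Fin.addCases with
  | left k => rw [stdNormal_castAdd] at h1 ⊢; exact h1
  | right k =>
    have hk : k ≠ i := fun e => hne (by rw [e])
    rw [stdNormal_natAdd] at h1 ⊢
    rwa [rowMove_of_ne hk]

end RowMove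

/-! ### Splitting a row move into single steps -/

/-- To relate the ends of an interval by a transitive relation, it suffices to treat intervals
that contain at most one of finitely many exceptional times. -/
theorem rel_of_finite_exceptions {T : Set ℝ} (hT : T.Finite) {ρ : ℝ → ℝ → Prop}
    (htrans : ∀ r s t, ρ r s → ρ s t → ρ r t) {A B : ℝ}
    (hρ : ∀ s t, A ≤ s → s < t → t ≤ B → s ∉ T → t ∉ T → (T ∩ Set.Icc s t).Subsingleton → ρ s t)
    (s t : ℝ) (hs : A ≤ s) (hst : s < t) (ht : t ≤ B) (hsT : s ∉ T) (htT : t ∉ T) : ρ s t := by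
  induction hk : (T ∩ Set.Icc s t).ncard using Nat.strong_induction_on generalizing s t with
  | _ k ih =>
    by_cases hsub : (T ∩ Set.Icc s t).Subsingleton
    · exact hρ s t hs hst ht hsT htT hsub
    rw [Set.not_subsingleton_iff] at hsub
    obtain ⟨p, hp, q, hq, hpq⟩ := hsub.exists_lt
    -- Cutting between two exceptional times `p < q` leaves fewer of them in each part.
    obtain ⟨r, hr, hrT⟩ : ∃ r ∈ Set.Ioo p q, r ∉ T := by
      by_contra! h
      exact (Set.Ioo_infinite hpq) (hT.subset h)
    have hfin : (T ∩ Set.Icc s t).Finite := hT.subset Set.inter_subset_left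
    have hsr : s < r := hp.2.1.trans_lt hr.1
    have hrt : r < t := hr.2.trans_le hq.2.2
    subst hk
    refine htrans s r t (ih _ ?_ s r hs hsr (hrt.le.trans ht) hsT hrT rfl)
      (ih _ ?_ r t (hs.trans hsr.le) hrt ht hrT htT rfl)
    · refine Set.ncard_lt_ncard ⟨fun x hx => ⟨hx.1, hx.2.1, hx.2.2.trans hrt.le⟩, fun h => ?_⟩ hfin
      exact (h hq).2.2.not_gt hr.2
    · refine Set.ncard_lt_ncard ⟨fun x hx => ⟨hx.1, hsr.le.trans hx.2.1, hx.2.2⟩, fun h => ?_⟩ hfin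
      exact (h hp).2.1.not_gt hr.1

/-- Standard figures joined by a chain of steps. -/
def Chain (M N : Fin d → E d) : Prop :=
  ∀ (hM : Good M) (hn : Nondegenerate (stdNormal M) (stdOffset d)) (hN : Good N)
    (hn' : Nondegenerate (stdNormal N) (stdOffset d)),
    Relation.ReflTransGen Step (stdFigure M hM hn) (stdFigure N hN hn')

/-- Degenerate times are times when a fixed vertex is hit, and each vertex is hit at most once, so
they are finite in number. An interval with none is a simple move; one with a single degenerate time
is a fundamental deformation by `huniq`. -/
theorem chain_rowMove {M : Fin d → E d} {i : Fin d} {w : E d} (hM : Good M)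
    (hn : Nondegenerate (stdNormal M) (stdOffset d)) (hw : ∀ j, 0 < w j)
    (hg : ∀ t ∈ Set.Icc (0 : ℝ) 1, Good (rowMove M i w t))
    (hn1 : Nondegenerate (stdNormal (rowMove M i w 1)) (stdOffset d))
    (huniq : ∀ t, ∀ u ∈ fixedVertices M i, ∀ v ∈ fixedVertices M i,
      inner ℝ (M i) u + t * inner ℝ w u = 1 → inner ℝ (M i) v + t * inner ℝ w v = 1 → u = v) :
    Chain M (rowMove M i w 1) := by
  let T : Set ℝ := {t ∈ Set.Icc (0 : ℝ) 1 |
    ¬ Nondegenerate (stdNormal (rowMove M i w t)) (stdOffset d)}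
  have hT0 : (0 : ℝ) ∉ T := fun h => h.2 (by rwa [rowMove_zero])
  have hT1 : (1 : ℝ) ∉ T := fun h => h.2 hn1
  have hT : T.Finite := by
    refine ((finite_fixedVertices M i).image
      fun v => (1 - inner ℝ (M i) v) / inner ℝ w v).subset fun t ht => ?_
    have ht0 : 0 < t := lt_of_le_of_ne ht.1.1 fun h => hT0 (h ▸ ht)
    obtain ⟨v, hv, h⟩ := exists_fixedVertex_of_not_nondegenerate hM hn hw ht0 (hg t ht.1) ht.2
    refine ⟨v, hv, ?_⟩
    have := inner_pos_of_hit hw hv h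
    simp only
    rw [div_eq_iff this.ne']
    linarith
  have hND : ∀ t, 0 ≤ t → t ≤ 1 → t ∉ T →
      Nondegenerate (stdNormal (rowMove M i w t)) (stdOffset d) := fun t h0 h1 ht => by
    by_contra h
    exact ht ⟨⟨h0, h1⟩, h⟩
  -- Goodness and nondegeneracy at the left end are included in the relation because composing two
  -- chains requires them at the middle system.
  have key := rel_of_finite_exceptions hT (ρ := fun s t =>
    Nondegenerate (stdNormal (rowMove M i w s)) (stdOffset d) ∧ Good (rowMove M i w s) ∧
      Chain (rowMove M i w s) (rowMove M i w t)) (A := 0) (B := 1) ?_ ?_ 0 1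
      le_rfl zero_lt_one le_rfl hT0 hT1
  · simpa using key.2.2
  · rintro r s t ⟨h1, h2, h3⟩ ⟨h4, h5, h6⟩
    exact ⟨h1, h2, fun hM hn hN hn' => (h3 hM hn h5 h4).trans (h6 h5 h4 hN hn')⟩
  · intro s t hs hst ht hsT htT hsub
    refine ⟨hND s hs (hst.le.trans ht) hsT, hg s ⟨hs, hst.le.trans ht⟩, fun hM' hn' hN hnN => ?_⟩
    have hts : 0 < t - s := sub_pos.2 hst
    have hN : rowMove M i w t = rowMove (rowMove M i w s) i ((t - s) • w) 1 := by
      rw [rowMove_rowMove]; congr 1; ring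
    have hw' : ∀ j, 0 < ((t - s) • w) j := fun j => by
      simpa using mul_pos hts (hw j)
    have hτ : ∀ τ ∈ Set.Icc (0 : ℝ) 1, s + τ * (t - s) ∈ Set.Icc s t := fun τ hτ => by
      have h1 := mul_nonneg hτ.1 hts.le
      have h2 := mul_nonneg (sub_nonneg.2 hτ.2) hts.le
      constructor <;> linarith
    have hg' : ∀ τ ∈ Set.Icc (0 : ℝ) 1,
        Good (rowMove (rowMove M i w s) i ((t - s) • w) τ) := fun τ h => by
      rw [rowMove_rowMove]
      exact hg _ ⟨hs.trans (hτ τ h).1, (hτ τ h).2.trans ht⟩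
    have hn'' : ∀ τ ∈ Set.Icc (0 : ℝ) 1, s + τ * (t - s) ∉ T →
        Nondegenerate (stdNormal (rowMove (rowMove M i w s) i ((t - s) • w) τ)) (stdOffset d) :=
      fun τ h hT => by
        rw [rowMove_rowMove]
        exact hND _ (hs.trans (hτ τ h).1) ((hτ τ h).2.trans ht) hT
    refine Relation.ReflTransGen.single ?_
    rcases (T ∩ Set.Icc s t).eq_empty_or_nonempty with hemp | ⟨t₁, ht₁, hmem⟩
    · exact Or.inr (step_of_nondegenerate hN _ _ _ _ hw' hg' fun τ h => hn'' τ h fun hT =>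
        Set.eq_empty_iff_forall_notMem.1 hemp _ ⟨hT, hτ τ h⟩)
    · left
      have hs1 : s < t₁ := lt_of_le_of_ne hmem.1 fun h => hsT (h ▸ ht₁)
      have ht1 : t₁ < t := lt_of_le_of_ne hmem.2 fun h => htT (h ▸ ht₁)
      have h0 : s + (t₁ - s) / (t - s) * (t - s) = t₁ := by field_simp; ring
      refine step_of_unique_hit hN _ _ _ _ hw' hg' (t₀ := (t₁ - s) / (t - s))
        ⟨div_pos (by linarith) hts, (div_lt_one hts).2 (by linarith)⟩ ?_ (fun τ h hne => ?_)
        fun u hu v hv h1 h2 => ?_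
      · rw [rowMove_rowMove, h0]
        exact ht₁.2
      · refine hn'' τ h fun hT => hne ?_
        rw [eq_div_iff hts.ne', ← hsub ⟨hT, hτ τ h⟩ ⟨ht₁, hmem⟩]
        ring
      · refine huniq t₁ u (fixedVertices_rowMove_subset hw hs hu) v
          (fixedVertices_rowMove_subset hw hs hv) ?_ ?_
        · rw [rowMove_self, inner_add_left, real_inner_smul_left, real_inner_smul_left,
            ← mul_assoc, add_assoc, ← add_mul, h0] at h1
          exact h1
        · rw [rowMove_self, inner_add_left, real_inner_smul_left, real_inner_smul_left,
            ← mul_assoc, add_assoc, ← add_mul, h0] at h2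
          exact h2

/-! ### Generic directions -/

theorem dense_inner_ne (g : E d) (c : ℝ) (h : g ≠ 0 ∨ c ≠ 0) :
    Dense {w : E d | inner ℝ g w ≠ c} := by
  intro w
  by_cases hw : inner ℝ g w = c
  · have hg : g ≠ 0 := by
      rintro rfl
      rw [inner_zero_left] at hw
      exact h.elim (fun h => h rfl) fun h => h hw.symm
    have hc : Filter.Tendsto (fun t : ℝ => w + t • g) (nhdsWithin 0 (Set.Ioi 0)) (nhds w) := by
      have : Continuous fun t : ℝ => w + t • g := by fun_prop
      simpa using (this.tendsto 0).mono_left nhdsWithin_le_nhds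
    refine mem_closure_of_tendsto hc (Filter.eventually_of_mem self_mem_nhdsWithin fun t ht => ?_)
    have := mul_pos ht (real_inner_self_pos.2 hg)
    simp only [Set.mem_ofPred_eq, inner_add_right, real_inner_smul_right, hw]
    linarith
  · exact subset_closure hw

theorem exists_generic {ι : Type*} [Finite ι] (g : ι → E d) (c : ι → ℝ)
    (h : ∀ k, g k ≠ 0 ∨ c k ≠ 0) {w₀ : E d} {U : Set (E d)} (hU : U ∈ nhds w₀) :
    ∃ w ∈ U, ∀ k, inner ℝ (g k) w ≠ c k := by
  have : Countable ι := Finite.to_countable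
  have hd : Dense (⋂ k, {w : E d | inner ℝ (g k) w ≠ c k}) :=
    dense_iInter_of_isOpen
      (fun k => isOpen_ne_fun (continuous_const.inner continuous_id) continuous_const)
      fun k => dense_inner_ne (g k) (c k) (h k)
  obtain ⟨w, hw, hwU⟩ := mem_closure_iff_nhds.1 (hd w₀) U hU
  exact ⟨w, hw, Set.mem_iInter.1 hwU⟩

/-- Only finitely many hyperplanes must be avoided. A hit of `v` at time 1 is one affine condition
on `w`. If `u ≠ v` are hit simultaneously, eliminating `t` makes `w` orthogonal to `(1 - ⟨M i, u⟩) v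
- (1 - ⟨M i, v⟩) u`, which is non-zero because neither vertex lies on the facet `i`. -/
theorem exists_generic_direction {M : Fin d → E d} (i : Fin d) {w₀ : E d} {U : Set (E d)}
    (hU : U ∈ nhds w₀) : ∃ w ∈ U,
    (∀ v ∈ fixedVertices M i, inner ℝ (M i) v + 1 * inner ℝ w v ≠ 1) ∧
    ∀ t, ∀ u ∈ fixedVertices M i, ∀ v ∈ fixedVertices M i,
      inner ℝ (M i) u + t * inner ℝ w u = 1 → inner ℝ (M i) v + t * inner ℝ w v = 1 → u = v := by
  have : Finite (fixedVertices M i) := finite_fixedVertices M i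
  have hne : ∀ v ∈ fixedVertices M i, inner ℝ (M i) v ≠ 1 := fun v hv h =>
    hv.2 (natAdd_mem_stdAct.2 h)
  let Q := {q : fixedVertices M i × fixedVertices M i // q.1 ≠ q.2}
  let p : Q → E d := fun q =>
    (1 - inner ℝ (M i) q.1.1.1) • q.1.2.1 - (1 - inner ℝ (M i) q.1.2.1) • q.1.1.1
  let g : fixedVertices M i ⊕ Q → E d := Sum.elim (fun v : fixedVertices M i => v.1) p
  let c : fixedVertices M i ⊕ Q → ℝ := Sum.elim (fun v : fixedVertices M i => 1 - inner ℝ (M i) v.1) fun _ => 0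
  have hgc : ∀ k, g k ≠ 0 ∨ c k ≠ 0 := by
    rintro (⟨v, hv⟩ | ⟨⟨⟨u, hu⟩, ⟨v, hv⟩⟩, huv⟩)
    · exact Or.inr (sub_ne_zero.2 (hne v hv).symm)
    · refine Or.inl fun h0 => huv (Subtype.ext ?_)
      simp only [g, Sum.elim_inr, p] at h0
      have h1 := congrArg (fun z => inner ℝ (M i) z) h0
      simp only [inner_sub_right, real_inner_smul_right, inner_zero_right] at h1
      have h2 : inner ℝ (M i) v = inner ℝ (M i) u := by linarith
      rw [h2, ← smul_sub, smul_eq_zero, sub_eq_zero, sub_eq_zero] at h0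
      exact (h0.resolve_left fun h => hne u hu h.symm).symm
  obtain ⟨w, hwU, hw⟩ := exists_generic g c hgc hU
  refine ⟨w, hwU, fun v hv h => ?_, fun t u hu v hv h1 h2 => ?_⟩
  · have := hw (Sum.inl ⟨v, hv⟩)
    simp only [g, c, Sum.elim_inl] at this
    rw [real_inner_comm] at this
    exact this (by linarith)
  · by_contra huv
    have := hw (Sum.inr ⟨(⟨u, hu⟩, ⟨v, hv⟩), fun e => huv (congrArg Subtype.val e)⟩)
    simp only [g, c, Sum.elim_inr, p, inner_sub_left, real_inner_smul_left] at this
    rw [real_inner_comm w v, real_inner_comm w u] at this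
    refine this ?_
    have e1 : 1 - inner ℝ (M i) u = t * inner ℝ w u := by linarith
    have e2 : 1 - inner ℝ (M i) v = t * inner ℝ w v := by linarith
    rw [e1, e2]
    ring

/-! ### Moving all rows -/

/-- Increasing one row inside a ball of good systems, up to an arbitrarily small change. -/
theorem exists_chain_update {N : Fin d → E d} {ε : ℝ} (hε : 0 < ε)
    (hball : ∀ M ∈ Metric.ball N ε, Good M) {M : Fin d → E d} (hM : M ∈ Metric.ball N ε)
    (hn : Nondegenerate (stdNormal M) (stdOffset d)) (i : Fin d) {p : E d}
    (hp : p ∈ Metric.ball (N i) ε) (hlt : ∀ j, M i j < p j) {U : Set (E d)} (hU : U ∈ nhds p) :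
    ∃ q ∈ U, Function.update M i q ∈ Metric.ball N ε ∧
      Nondegenerate (stdNormal (Function.update M i q)) (stdOffset d) ∧
      Chain M (Function.update M i q) := by
  have hc : Continuous fun w : E d => M i + w := by fun_prop
  have hpe : M i + (p - M i) = p := by abel
  have hV : ∀ᶠ w in nhds (p - M i), (M i + w ∈ U ∧ M i + w ∈ Metric.ball (N i) ε) ∧
      ∀ j, 0 < w j := by
    refine Filter.Eventually.and ?_ (Filter.eventually_all.2 fun j => ?_)
    · refine hc.continuousAt.eventually (p := fun z => z ∈ U ∧ z ∈ Metric.ball (N i) ε) ?_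
      change U ∩ Metric.ball (N i) ε ∈ nhds (M i + (p - M i))
      rw [hpe]
      exact Filter.inter_mem hU (Metric.isOpen_ball.mem_nhds hp)
    · have : Continuous fun w : E d => w j := by fun_prop
      exact this.continuousAt.eventually (lt_mem_nhds (by simpa using hlt j))
  obtain ⟨w, ⟨⟨hwU, hwb⟩, hw⟩, hw1, huniq⟩ := exists_generic_direction (M := M) i hV
  have hrow : rowMove M i w 1 = Function.update M i (M i + w) := by simp [rowMove]
  -- In the sup metric the ball is a product of balls, and the moving row stays in a convex one.
  have hmem : ∀ t ∈ Set.Icc (0 : ℝ) 1, rowMove M i w t ∈ Metric.ball N ε := fun t ht => by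
    rw [Metric.mem_ball, dist_pi_lt_iff hε] at hM ⊢
    intro k
    by_cases hk : k = i
    · subst hk
      rw [rowMove_self]
      have h1 := convex_ball (N k) ε (Metric.mem_ball.2 (hM k)) hwb (sub_nonneg.2 ht.2) ht.1
        (by ring)
      have h2 : (1 - t) • M k + t • (M k + w) = M k + t • w := by module
      rwa [h2, Metric.mem_ball] at h1
    · rw [rowMove_of_ne hk]
      exact hM k
  have hg : ∀ t ∈ Set.Icc (0 : ℝ) 1, Good (rowMove M i w t) := fun t ht => hball _ (hmem t ht)
  have h1 : (1 : ℝ) ∈ Set.Icc (0 : ℝ) 1 := by simp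
  have hn1 : Nondegenerate (stdNormal (rowMove M i w 1)) (stdOffset d) := by
    by_contra hno
    obtain ⟨v, hv, h⟩ := exists_fixedVertex_of_not_nondegenerate (hball M hM) hn hw zero_lt_one
      (hg 1 h1) hno
    exact hw1 v hv h
  exact ⟨M i + w, hwU, hrow ▸ hmem 1 h1, hrow ▸ hn1,
    hrow ▸ chain_rowMove (hball M hM) hn hw hg hn1 huniq⟩

/-! ### Following increasing paths up to small errors -/

/-- Every nondegenerate system near `M` can be moved by a chain of steps to a nondegenerate system
as close to `N` as desired. -/
def Reaches (M N : Fin d → E d) : Prop :=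
  ∀ U ∈ nhds N, ∃ V ∈ nhds M, ∀ M' ∈ V, Nondegenerate (stdNormal M') (stdOffset d) →
    ∃ N' ∈ U, Nondegenerate (stdNormal N') (stdOffset d) ∧ Chain M' N'

theorem Reaches.refl (M : Fin d → E d) : Reaches M M := fun U hU =>
  ⟨U, hU, fun M' hM' hn => ⟨M', hM', hn, fun _ _ _ _ => Relation.ReflTransGen.refl⟩⟩

/-- The neighbourhood of starting systems in the second relation absorbs the error at the end of the
first chain. Shrinking it to good systems allows the chains to be composed. -/
theorem Reaches.trans {L M N : Fin d → E d} (hM : Good M) (h : Reaches L M) (h' : Reaches M N) :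
    Reaches L N := by
  intro U hU
  obtain ⟨V, hV, h1⟩ := h' U hU
  obtain ⟨W, hW, h2⟩ := h (V ∩ {M | Good M}) (Filter.inter_mem hV (isOpen_good.mem_nhds hM))
  refine ⟨W, hW, fun L' hL' hn => ?_⟩
  obtain ⟨M', ⟨hM', hgood⟩, hnM, hc⟩ := h2 L' hL' hn
  obtain ⟨N', hN', hnN, hc'⟩ := h1 M' hM' hnM
  exact ⟨N', hN', hnN, fun hL hnL hN hnN => (hc hL hnL hgood hnM).trans (hc' hgood hnM hN hnN)⟩

/-- The rows are moved one after another. Rows not yet treated are those of the starting system,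
hence still below their targets, and systems with mixed rows remain in the ball because it is a
product. -/
theorem reaches_of_mem_ball {N : Fin d → E d} {ε : ℝ} (hε : 0 < ε)
    (hball : ∀ M ∈ Metric.ball N ε, Good M) {M M' : Fin d → E d} (hM : M ∈ Metric.ball N ε)
    (hM' : M' ∈ Metric.ball N ε) (hlt : ∀ i j, M i j < M' i j) : Reaches M M' := by
  classical
  intro U hU
  have hcoord : ∀ i j, Continuous fun L : Fin d → E d => L i j := fun i j => by fun_prop
  obtain ⟨δ, hδ, hδU⟩ := Metric.mem_nhds_iff.1 hU
  refine ⟨Metric.ball N ε ∩ {L | ∀ i j, L i j < M' i j},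
    Filter.inter_mem (Metric.isOpen_ball.mem_nhds hM) ?_, ?_⟩
  · exact Filter.eventually_all.2 fun i => Filter.eventually_all.2 fun j =>
      (hcoord i j).continuousAt.eventually (gt_mem_nhds (hlt i j))
  rintro L ⟨hL, hLt⟩ hn
  have key : ∀ S : Finset (Fin d), ∃ K ∈ Metric.ball N ε, (∀ i ∈ S, K i ∈ Metric.ball (M' i) δ) ∧
      (∀ i, i ∉ S → K i = L i) ∧ Nondegenerate (stdNormal K) (stdOffset d) ∧ Chain L K := by
    intro S
    induction S using Finset.induction_on with
    | empty => exact ⟨L, hL, by simp, by simp, hn, fun _ _ _ _ => Relation.ReflTransGen.refl⟩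
    | insert i S hi ih =>
      obtain ⟨K, hK, h1, h2, h3, h4⟩ := ih
      have hp : M' i ∈ Metric.ball (N i) ε := by
        rw [Metric.mem_ball, dist_pi_lt_iff hε] at hM'
        exact hM' i
      obtain ⟨q, hq, h5, h6, h7⟩ := exists_chain_update hε hball hK h3 i hp
        (fun j => by rw [h2 i hi]; exact hLt i j) (Metric.ball_mem_nhds (M' i) hδ)
      refine ⟨_, h5, fun k hk => ?_, fun k hk => ?_, h6, fun ha hb hc hd =>
        (h4 ha hb (hball K hK) h3).trans (h7 (hball K hK) h3 hc hd)⟩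
      · by_cases hki : k = i
        · subst hki; simpa using hq
        · rw [Function.update_of_ne hki]
          exact h1 k ((Finset.mem_insert.1 hk).resolve_left hki)
      · rw [Finset.mem_insert, not_or] at hk
        rw [Function.update_of_ne hk.1, h2 k hk.2]
  obtain ⟨K, -, h1, -, h3, h4⟩ := key Finset.univ
  refine ⟨K, hδU ?_, h3, h4⟩
  rw [Metric.mem_ball, dist_pi_lt_iff hδ]
  exact fun i => h1 i (Finset.mem_univ i)

/-- Straight increasing paths of good systems can be followed. -/
theorem reaches_of_segment {M W : Fin d → E d} (hW : ∀ i j, 0 < W i j)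
    (hg : ∀ t ∈ Set.Icc (0 : ℝ) 1, Good (M + t • W)) : Reaches M (M + W) := by
  have hball : ∀ t : unitInterval, ∃ ε > 0, ∀ L ∈ Metric.ball (M + (t : ℝ) • W) ε, Good L :=
    fun t => Metric.isOpen_iff.1 isOpen_good _ (hg t t.2)
  choose ε hε hball using hball
  have hcont : Continuous fun t : unitInterval => M + (t : ℝ) • W := by fun_prop
  -- Subdivide the segment so that each piece lies in one ball of good systems.
  obtain ⟨τ, h0, hmono, ⟨m, hm⟩, hτ⟩ := exists_monotone_Icc_subset_open_cover_unitInterval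
    (c := fun s : unitInterval => {t | M + (t : ℝ) • W ∈ Metric.ball (M + (s : ℝ) • W) (ε s)})
    (fun s => Metric.isOpen_ball.preimage hcont)
    fun t _ => Set.mem_iUnion.2 ⟨t, Metric.mem_ball_self (hε t)⟩
  have key : ∀ k, Reaches M (M + (τ k : ℝ) • W) := by
    intro k
    induction k with
    | zero => rw [h0]; simpa using Reaches.refl M
    | succ k ih =>
      refine Reaches.trans (hg _ (τ k).2) ih ?_
      obtain ⟨s, hs⟩ := hτ k
      have hle : τ k ≤ τ (k + 1) := hmono (Nat.le_succ k)
      rcases hle.eq_or_lt with heq | hlt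
      · rw [heq]
        exact Reaches.refl _
      · refine reaches_of_mem_ball (hε s) (hball s) (hs ⟨le_rfl, hle⟩) (hs ⟨hle, le_rfl⟩)
          fun i j => ?_
        have : (τ k : ℝ) < τ (k + 1) := hlt
        have := mul_lt_mul_of_pos_right this (hW i j)
        simpa using this
  have := key m
  rw [hm m le_rfl] at this
  simpa using this

/-! ### Invertible matrices of positive determinant are joined by polygonal paths -/

section Linked

open Matrix

variable {ι : Type*} [Fintype ι] [DecidableEq ι]

/-- The segment between two matrices consists of invertible matrices. -/
def SegInv (A B : Matrix ι ι ℝ) : Prop :=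
  ∀ t ∈ Set.Icc (0 : ℝ) 1, ((1 - t) • A + t • B).det ≠ 0

/-- The matrices are joined by a polygonal path of invertible matrices. -/
def Linked : Matrix ι ι ℝ → Matrix ι ι ℝ → Prop := Relation.ReflTransGen SegInv

theorem SegInv.refl {A : Matrix ι ι ℝ} (h : A.det ≠ 0) : SegInv A A := fun t _ => by
  rwa [← add_smul, sub_add_cancel, one_smul]

theorem SegInv.symm {A B : Matrix ι ι ℝ} (h : SegInv A B) : SegInv B A := fun t ht => by
  have := h (1 - t) ⟨by linarith [ht.2], by linarith [ht.1]⟩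
  rwa [sub_sub_cancel, add_comm] at this

theorem SegInv.mul_left {A B C : Matrix ι ι ℝ} (h : SegInv A B) (hC : C.det ≠ 0) :
    SegInv (C * A) (C * B) := fun t ht => by
  have : (1 - t) • (C * A) + t • (C * B) = C * ((1 - t) • A + t • B) := by
    rw [mul_add, Matrix.mul_smul, Matrix.mul_smul]
  rw [this, det_mul]
  exact mul_ne_zero hC (h t ht)

theorem SegInv.mul_right {A B C : Matrix ι ι ℝ} (h : SegInv A B) (hC : C.det ≠ 0) :
    SegInv (A * C) (B * C) := fun t ht => by
  have : (1 - t) • (A * C) + t • (B * C) = ((1 - t) • A + t • B) * C := by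
    rw [add_mul, Matrix.smul_mul, Matrix.smul_mul]
  rw [this, det_mul]
  exact mul_ne_zero (h t ht) hC

theorem SegInv.det_mul_pos {A B : Matrix ι ι ℝ} (h : SegInv A B) : 0 < A.det * B.det := by
  let f : ℝ → ℝ := fun t => ((1 - t) • A + t • B).det
  have hf : Continuous f := by
    refine Continuous.matrix_det ?_
    fun_prop
  have h0 : f 0 = A.det := by simp [f]
  have h1 : f 1 = B.det := by simp [f]
  have hne : ∀ t ∈ Set.Icc (0 : ℝ) 1, f t ≠ 0 := h
  have hA := hne 0 (by simp)
  have hB := hne 1 (by simp)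
  rw [h0] at hA
  rw [h1] at hB
  rcases hA.lt_or_gt with hA | hA <;> rcases hB.lt_or_gt with hB | hB
  · exact mul_pos_of_neg_of_neg hA hB
  · obtain ⟨t, ht, h⟩ := intermediate_value_Icc zero_le_one hf.continuousOn
      (⟨h0 ▸ hA.le, h1 ▸ hB.le⟩ : (0 : ℝ) ∈ Set.Icc (f 0) (f 1))
    exact absurd h (hne t ht)
  · obtain ⟨t, ht, h⟩ := intermediate_value_Icc' zero_le_one hf.continuousOn
      (⟨h1 ▸ hB.le, h0 ▸ hA.le⟩ : (0 : ℝ) ∈ Set.Icc (f 1) (f 0))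
    exact absurd h (hne t ht)
  · exact mul_pos hA hB

theorem SegInv.det_ne_zero {A B : Matrix ι ι ℝ} (h : SegInv A B) : A.det ≠ 0 :=
  left_ne_zero_of_mul h.det_mul_pos.ne'

namespace Linked

theorem symm {A B : Matrix ι ι ℝ} (h : Linked A B) : Linked B A := by
  induction h with
  | refl => exact .refl
  | tail _ h ih => exact .head h.symm ih

theorem mul_left {A B C : Matrix ι ι ℝ} (h : Linked A B) (hC : C.det ≠ 0) :
    Linked (C * A) (C * B) := by
  induction h with
  | refl => exact .refl
  | tail _ h ih => exact .tail ih (h.mul_left hC)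

theorem mul_right {A B C : Matrix ι ι ℝ} (h : Linked A B) (hC : C.det ≠ 0) :
    Linked (A * C) (B * C) := by
  induction h with
  | refl => exact .refl
  | tail _ h ih => exact .tail ih (h.mul_right hC)

theorem det_mul_pos {A B : Matrix ι ι ℝ} (h : Linked A B) (hA : A.det ≠ 0) :
    0 < A.det * B.det := by
  induction h with
  | refl => exact mul_self_pos.2 hA
  | @tail B C _ h ih =>
    have h1 := mul_pos ih h.det_mul_pos
    have h2 := mul_self_pos.2 h.det_ne_zero
    have h3 : 0 < A.det * C.det * (B.det * B.det) := by linarith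
    exact pos_of_mul_pos_left h3 h2.le

theorem mul_of_one {A B C : Matrix ι ι ℝ} (hA : Linked A 1) (h : Linked B C) (hB : B.det ≠ 0) :
    Linked (A * B) C := by
  have := hA.mul_right hB
  rw [one_mul] at this
  exact this.trans h

end Linked

theorem linked_transvection {i j : ι} (hij : i ≠ j) (c : ℝ) : Linked (transvection i j c) 1 := by
  refine .single (SegInv.symm fun t _ => ?_)
  have : (1 - t) • (1 : Matrix ι ι ℝ) + t • transvection i j c = transvection i j (t * c) := by
    rw [transvection, transvection, smul_add, ← add_assoc, ← add_smul, sub_add_cancel, one_smul,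
      smul_single, smul_eq_mul]
  rw [this, det_transvection_of_ne _ _ hij]
  exact one_ne_zero

/-- The reflection in the coordinate `i`. -/
def coordReflection (i : ι) : Matrix ι ι ℝ := 1 - single i i 2

theorem coordReflection_eq_diagonal {κ : Type*} [DecidableEq κ] (i : κ) :
    coordReflection i = diagonal (Function.update 1 i (-1)) := by
  ext j k
  by_cases hjk : j = k
  · subst hjk
    by_cases hj : j = i
    · subst hj; simp [coordReflection]; norm_num
    · simp [coordReflection, hj, Ne.symm hj]
  · by_cases hj : i = j
    · subst hj; simp [coordReflection, hjk]
    · simp [coordReflection, hjk, hj]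

theorem det_coordReflection (i : ι) : (coordReflection i : Matrix ι ι ℝ).det = -1 := by
  rw [coordReflection_eq_diagonal, det_diagonal, Finset.prod_update_of_mem (Finset.mem_univ i)]
  simp

theorem coordReflection_mul_self (i : ι) :
    (coordReflection i * coordReflection i : Matrix ι ι ℝ) = 1 := by
  simp only [coordReflection, mul_sub, sub_mul, one_mul, mul_one, single_mul_single_same]
  rw [show (2 * 2 : ℝ) = 2 + 2 by norm_num, single_add]
  abel

/-- The quarter turn `W` in the plane of `i` and `j` is a product of three transvections, hence
linked to `1`, and it conjugates one reflection into the other: `W * coordReflection i =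
coordReflection j * W`. -/
theorem linked_coordReflection (i j : ι) :
    Linked (coordReflection i : Matrix ι ι ℝ) (coordReflection j) := by
  by_cases hij : i = j
  · subst hij; exact Relation.ReflTransGen.refl
  let W : Matrix ι ι ℝ := transvection i j 1 * transvection j i (-1) * transvection i j 1
  have hdet : W.det = 1 := by
    simp [W, det_transvection_of_ne, hij, Ne.symm hij]
  have hW : Linked W 1 := by
    refine Linked.mul_of_one ?_ (linked_transvection hij 1)
      (by simp [det_transvection_of_ne, hij])
    exact Linked.mul_of_one (linked_transvection hij 1) (linked_transvection (Ne.symm hij) (-1))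
      (by simp [det_transvection_of_ne, Ne.symm hij])
  have hWeq : W = 1 + single i j 1 - single j i 1 - single i i 1 - single j j 1 := by
    have hneg : (single j i (-1) : Matrix ι ι ℝ) = -single j i 1 := by
      ext k l; by_cases h : j = k ∧ i = l <;> simp [h]
    simp only [W, transvection, hneg, mul_add, add_mul, one_mul, mul_one, mul_neg, neg_mul,
      single_mul_single_same, single_mul_single_of_ne, ne_eq, Ne.symm hij,
      not_false_eq_true]
    abel
  have hcomm : W * coordReflection i = coordReflection j * W := by
    simp only [hWeq, coordReflection, mul_sub, sub_mul, mul_add, add_mul, one_mul, mul_one,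
      single_mul_single_same, single_mul_single_of_ne, ne_eq, Ne.symm hij, not_false_eq_true]
    abel
  have h1 := hW.mul_right (C := coordReflection i) (by rw [det_coordReflection]; norm_num)
  have h2 := hW.mul_left (C := coordReflection j) (by rw [det_coordReflection]; norm_num)
  rw [one_mul, hcomm] at h1
  rw [mul_one] at h2
  exact h1.symm.trans h2

theorem segInv_diagonal {D D' : ι → ℝ} (h : ∀ i, 0 < D i * D' i) :
    SegInv (diagonal D) (diagonal D') := fun t ht => by
  have : (1 - t) • diagonal D + t • diagonal D' =
      diagonal fun i => (1 - t) * D i + t * D' i := by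
    rw [← diagonal_smul, ← diagonal_smul, diagonal_add]
    rfl
  rw [this, det_diagonal]
  refine Finset.prod_ne_zero_iff.2 fun i _ h0 => ?_
  have hne : D i ≠ 0 := left_ne_zero_of_mul (h i).ne'
  have h1 := mul_nonneg (sub_nonneg.2 ht.2) (mul_self_nonneg (D i))
  have h2 := mul_nonneg ht.1 (h i).le
  have h3 : (1 - t) * (D i * D i) + t * (D i * D' i) = 0 := by
    have : D i * ((1 - t) * D i + t * D' i) = 0 := by rw [h0, mul_zero]
    linarith
  have h4 : (1 - t) * (D i * D i) = 0 := by linarith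
  have h5 : t * (D i * D' i) = 0 := by linarith
  have h6 := (mul_eq_zero.1 h4).resolve_right (mul_self_pos.2 hne).ne'
  have h7 := (mul_eq_zero.1 h5).resolve_right (h i).ne'
  linarith

/-- By elimination it suffices to treat transvections and diagonal matrices, because the property is
multiplicative: the reflection squares to `1`. A diagonal matrix is built entry by entry, a positive
entry being linked to `1` and a negative one to a reflection. -/
theorem linked_one_or_reflection (i₀ : ι) (M : Matrix ι ι ℝ) (hM : M.det ≠ 0) :
    Linked M 1 ∨ Linked M (coordReflection i₀) := by
  have hR : (coordReflection i₀ : Matrix ι ι ℝ).det ≠ 0 := by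
    rw [det_coordReflection]; norm_num
  have hmul : ∀ A B : Matrix ι ι ℝ, A.det ≠ 0 → B.det ≠ 0 →
      (Linked A 1 ∨ Linked A (coordReflection i₀)) →
      (Linked B 1 ∨ Linked B (coordReflection i₀)) →
      (Linked (A * B) 1 ∨ Linked (A * B) (coordReflection i₀)) := by
    rintro A B _ hB (hA1 | hA1) hB1
    · exact hB1.imp (fun h => hA1.mul_of_one h hB) fun h => hA1.mul_of_one h hB
    · have h1 := hA1.mul_right hB
      rcases hB1 with hB1 | hB1
      · have h2 := hB1.mul_left hR
        rw [mul_one] at h2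
        exact Or.inr (h1.trans h2)
      · have h2 := hB1.mul_left hR
        rw [coordReflection_mul_self] at h2
        exact Or.inl (h1.trans h2)
  refine diagonal_transvection_induction_of_det_ne_zero
    (fun M => Linked M 1 ∨ Linked M (coordReflection i₀)) M hM (fun D hD => ?_)
    (fun ⟨i, j, hij, c⟩ => Or.inl (linked_transvection hij c)) hmul
  · rw [det_diagonal, Finset.prod_ne_zero_iff] at hD
    have key : ∀ S : Finset ι, Linked (diagonal fun i => if i ∈ S then D i else 1) 1 ∨
        Linked (diagonal fun i => if i ∈ S then D i else 1) (coordReflection i₀) := by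
      intro S
      induction S using Finset.induction_on with
      | empty =>
        left
        simp only [Finset.notMem_empty, if_false, diagonal_one]
        exact Relation.ReflTransGen.refl
      | insert i S hi ih =>
        have hprod : (diagonal fun k => if k ∈ insert i S then D k else 1) =
            diagonal (Function.update 1 i (D i)) * diagonal fun k => if k ∈ S then D k else 1 := by
          rw [diagonal_mul_diagonal]
          congr 1
          ext k
          by_cases hk : k = i
          · subst hk; simp [hi]
          · simp [hk]
        rw [hprod]
        refine hmul _ _ ?_ ?_ ?_ ih
        · rw [det_diagonal, Finset.prod_update_of_mem (Finset.mem_univ i)]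
          simpa using hD i (Finset.mem_univ i)
        · rw [det_diagonal, Finset.prod_ne_zero_iff]
          intro k _
          split_ifs
          · exact hD k (Finset.mem_univ k)
          · exact one_ne_zero
        · rcases (hD i (Finset.mem_univ i)).lt_or_gt with hneg | hpos
          · right
            refine Relation.ReflTransGen.trans (.single ?_) (linked_coordReflection i i₀)
            rw [coordReflection_eq_diagonal]
            refine segInv_diagonal fun k => ?_
            by_cases hk : k = i
            · subst hk; simpa using hneg
            · simp [hk]
          · left
            rw [← diagonal_one]
            refine .single (segInv_diagonal fun k => ?_)
            by_cases hk : k = i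
            · subst hk; simpa using hpos
            · simp [hk]
    simpa using key Finset.univ

/-- Invertible matrices with determinants of the same sign are joined by a polygonal path. -/
theorem linked_of_det_mul_pos [Nonempty ι] {A B : Matrix ι ι ℝ} (h : 0 < A.det * B.det) :
    Linked A B := by
  have hA : A.det ≠ 0 := left_ne_zero_of_mul h.ne'
  have hB : B.det ≠ 0 := right_ne_zero_of_mul h.ne'
  let i₀ : ι := Classical.arbitrary ι
  rcases linked_one_or_reflection i₀ A hA with h1 | h1 <;>
    rcases linked_one_or_reflection i₀ B hB with h2 | h2
  · exact h1.trans h2.symm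
  · have h3 := h1.det_mul_pos hA
    have h4 := h2.det_mul_pos hB
    rw [det_one] at h3
    rw [det_coordReflection] at h4
    nlinarith
  · have h3 := h1.det_mul_pos hA
    have h4 := h2.det_mul_pos hB
    rw [det_one] at h4
    rw [det_coordReflection] at h3
    nlinarith
  · exact h1.trans h2.symm

end Linked

/-! ### Systems with constant row sums -/

section RowsOf

variable {m : ℕ}

/-- The rows whose differences from the first row `c` have row sum zero and are given by `A` in the
last coordinates. -/
noncomputable def rowsOf (A : Matrix (Fin m) (Fin m) ℝ) (c : Fin (m + 1) → ℝ) :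
    Fin (m + 1) → E (m + 1) :=
  Fin.cons (WithLp.toLp 2 c) fun i =>
    WithLp.toLp 2 (c + Fin.cons (-∑ j, A i j) (A i))

theorem rowsOf_zero (A : Matrix (Fin m) (Fin m) ℝ) (c : Fin (m + 1) → ℝ) (j : Fin (m + 1)) :
    rowsOf A c 0 j = c j := by simp [rowsOf]

theorem rowsOf_succ_zero (A : Matrix (Fin m) (Fin m) ℝ) (c : Fin (m + 1) → ℝ) (i : Fin m) :
    rowsOf A c i.succ 0 = c 0 - ∑ j, A i j := by simp [rowsOf, sub_eq_add_neg]

theorem rowsOf_succ_succ (A : Matrix (Fin m) (Fin m) ℝ) (c : Fin (m + 1) → ℝ) (i j : Fin m) :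
    rowsOf A c i.succ j.succ = c j.succ + A i j := by simp [rowsOf]

theorem rowsOf_ext {M : Fin (m + 1) → E (m + 1)} {A : Matrix (Fin m) (Fin m) ℝ}
    {c : Fin (m + 1) → ℝ} (h0 : ∀ j, M 0 j = c j) (h1 : ∀ i : Fin m, M i.succ 0 = c 0 - ∑ j, A i j)
    (h2 : ∀ i j : Fin m, M i.succ j.succ = c j.succ + A i j) : M = rowsOf A c := by
  ext i j
  refine Fin.cases ?_ (fun i => ?_) i
  · rw [h0, rowsOf_zero]
  · refine Fin.cases ?_ (fun j => ?_) j
    · rw [h1, rowsOf_succ_zero]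
    · rw [h2, rowsOf_succ_succ]

theorem inner_rowsOf_zero (A : Matrix (Fin m) (Fin m) ℝ) (c : Fin (m + 1) → ℝ) (z : E (m + 1)) :
    inner ℝ (rowsOf A c 0) z = ∑ j, c j * z j := by
  simp [inner_eq_sum, rowsOf_zero]

theorem inner_rowsOf_succ (A : Matrix (Fin m) (Fin m) ℝ) (c : Fin (m + 1) → ℝ) (i : Fin m)
    (z : E (m + 1)) : inner ℝ (rowsOf A c i.succ) z =
      ∑ j, c j * z j + ∑ j, A i j * (z j.succ - z 0) := by
  rw [inner_eq_sum, Fin.sum_univ_succ, Fin.sum_univ_succ (fun j => c j * z j), rowsOf_succ_zero]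
  simp only [rowsOf_succ_succ, add_mul, mul_sub, Finset.sum_add_distrib, Finset.sum_sub_distrib,
    sub_mul, Finset.sum_mul]
  ring

/-- All rows have the sum of `c`, so a constant vector serves as `y`. A vector killed by all rows
has `A` times its differences `u j.succ - u 0` equal to zero, so it is constant, and then zero since
the row sum is positive. -/
theorem good_rowsOf {A : Matrix (Fin m) (Fin m) ℝ} {c : Fin (m + 1) → ℝ} (hA : A.det ≠ 0)
    (hpos : ∀ i j, 0 < rowsOf A c i j) : Good (rowsOf A c) := by
  have hc : 0 < ∑ j, c j := Finset.sum_pos (fun j _ => by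
    rw [← rowsOf_zero A c]; exact hpos 0 j) Finset.univ_nonempty
  refine ⟨hpos, fun u hu => ?_, WithLp.toLp 2 fun _ => (∑ j, c j)⁻¹, fun _ => inv_pos.2 hc,
    fun i => ?_⟩
  · have h0 := hu 0
    rw [inner_rowsOf_zero] at h0
    have h1 : A.mulVec (fun j => u j.succ - u 0) = 0 := by
      ext i
      have := hu i.succ
      rw [inner_rowsOf_succ, h0, zero_add] at this
      exact this
    have h2 := Matrix.eq_zero_of_mulVec_eq_zero hA h1
    have h3 : ∀ j, u j = u 0 := fun j =>
      Fin.cases rfl (fun j => sub_eq_zero.1 (congrFun h2 j)) j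
    have h4 : (∑ j, c j) * u 0 = 0 := by
      rw [Finset.sum_mul, ← h0]
      exact Finset.sum_congr rfl fun j _ => by rw [h3 j]
    have h5 := (mul_eq_zero.1 h4).resolve_left hc.ne'
    ext j
    rw [h3 j, h5]; rfl
  · have h1 : ∑ j, c j * (∑ j, c j)⁻¹ = 1 := by
      rw [← Finset.sum_mul, mul_inv_cancel₀ hc.ne']
    refine Fin.cases ?_ (fun i => ?_) i
    · rw [inner_rowsOf_zero]
      exact h1
    · rw [inner_rowsOf_succ]
      simp [h1]

theorem rowsOf_segment (A A' : Matrix (Fin m) (Fin m) ℝ) (c c' : Fin (m + 1) → ℝ) (t : ℝ) :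
    rowsOf A c + t • (rowsOf A' c' - rowsOf A c) =
      rowsOf ((1 - t) • A + t • A') ((1 - t) • c + t • c') := by
  refine rowsOf_ext (fun j => ?_) (fun i => ?_) fun i j => ?_
  · simp [rowsOf_zero]; ring
  · simp [rowsOf_succ_zero, Finset.sum_add_distrib, ← Finset.mul_sum]; ring
  · simp [rowsOf_succ_succ]; ring

theorem exists_forall_lt {κ : Type*} [Finite κ] (f : κ → ℝ) : ∃ K, ∀ k, f k < K := by
  obtain ⟨K, hK⟩ := (Set.finite_range f).bddAbove
  exact ⟨K + 1, fun k => (hK ⟨k, rfl⟩).trans_lt (lt_add_one K)⟩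

/-- Every positive system with differences `A` reaches some system with differences `B` and
arbitrarily large first row. -/
def Climbs (A B : Matrix (Fin m) (Fin m) ℝ) : Prop :=
  ∀ c, (∀ i j, 0 < rowsOf A c i j) → ∀ C : ℝ, ∃ c', (∀ j, C ≤ c' j) ∧
    (∀ i j, 0 < rowsOf B c' i j) ∧ Reaches (rowsOf A c) (rowsOf B c')

/-- Raising `c` by a large constant makes every entry of the target exceed that of the source. Since
`rowsOf` is affine in both arguments, goodness along the straight path needs only invertibility of
the matrices between `A` and `B`. The constant `K` secures the increase and `L` the bound `C`. -/
theorem SegInv.climbs {A B : Matrix (Fin m) (Fin m) ℝ} (h : SegInv A B) : Climbs A B := by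
  intro c hc C
  obtain ⟨K, hK⟩ := exists_forall_lt fun p : Fin (m + 1) × Fin (m + 1) =>
    rowsOf A c p.1 p.2 - rowsOf B c p.1 p.2
  obtain ⟨L, hL⟩ := exists_forall_lt fun j => C - c j
  let c' : Fin (m + 1) → ℝ := fun j => c j + max K L
  have hB : ∀ i j, rowsOf B c' i j = rowsOf B c i j + max K L := fun i j => by
    refine Fin.cases ?_ (fun i => ?_) i
    · simp [rowsOf_zero, c']
    · refine Fin.cases ?_ (fun j => ?_) j
      · simp [rowsOf_succ_zero, c']; ring
      · simp [rowsOf_succ_succ, c']; ring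
  have hlt : ∀ i j, rowsOf A c i j < rowsOf B c' i j := fun i j => by
    have h1 := hK (i, j)
    have h2 := le_max_left K L
    rw [hB]
    simp only at h1
    linarith
  refine ⟨c', fun j => ?_, fun i j => (hc i j).trans (hlt i j), ?_⟩
  · have h1 := hL j
    have h2 := le_max_right K L
    simp only [c']
    linarith
  · have hW : ∀ i j, 0 < (rowsOf B c' - rowsOf A c) i j := fun i j => sub_pos.2 (hlt i j)
    have := reaches_of_segment (M := rowsOf A c) hW fun t ht => ?_
    · rwa [add_sub_cancel] at this
    · have hpos : ∀ i j, 0 < (rowsOf A c + t • (rowsOf B c' - rowsOf A c)) i j := fun i j =>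
        add_pos_of_pos_of_nonneg (hc i j) (mul_nonneg ht.1 (hW i j).le)
      rw [rowsOf_segment] at hpos ⊢
      exact good_rowsOf (h t ht) hpos

theorem Linked.climbs {A B : Matrix (Fin m) (Fin m) ℝ} (hA : A.det ≠ 0) (h : Linked A B) :
    Climbs A B := by
  induction h with
  | refl => exact (SegInv.refl hA).climbs
  | tail _ h ih =>
    intro c hc C
    obtain ⟨c', -, h1, h2⟩ := ih c hc C
    obtain ⟨c'', h3, h4, h5⟩ := h.climbs c' h1 C
    exact ⟨c'', h3, h4, h2.trans (good_rowsOf h.det_ne_zero h1) h5⟩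

end RowsOf

/-! ### Every figure has the type of a standard figure -/

/-- A description of a figure by constraints of which the first `d` are tight at `x` and the last
`d` at `y`. -/
structure Describes (a : Fin (d + d) → E d) (b : Fin (d + d) → ℝ) (D : Figure d) : Prop where
  poly : D.P = polyhedron a b
  nondegenerate : Nondegenerate a b
  act_x : act a b D.x = Set.range (Fin.castAdd d)
  act_y : act a b D.y = Set.range (Fin.natAdd d)

/-- The slack of the constraint `k` at `z`. -/
noncomputable def slack (a : Fin (d + d) → E d) (b : Fin (d + d) → ℝ) (k : Fin (d + d)) (z : E d) :
    ℝ := b k - inner ℝ (a k) z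

/-- The last `d` slacks as affine functions of the first `d`, normalized at `x` and `y`. -/
def SlackMatrix (a : Fin (d + d) → E d) (b : Fin (d + d) → ℝ) (D : Figure d)
    (M : Fin d → Fin d → ℝ) : Prop :=
  ∀ i z, slack a b (Fin.natAdd d i) z = slack a b (Fin.natAdd d i) D.x *
    (1 - ∑ j, M i j * (slack a b (Fin.castAdd d j) z / slack a b (Fin.castAdd d j) D.y))

theorem mem_act_iff_slack {a : Fin (d + d) → E d} {b : Fin (d + d) → ℝ} {k : Fin (d + d)}
    {z : E d} : k ∈ act a b z ↔ slack a b k z = 0 := by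
  rw [mem_act, slack, sub_eq_zero, eq_comm]

theorem mem_polyhedron_iff_slack {a : Fin (d + d) → E d} {b : Fin (d + d) → ℝ}
    {z : E d} : z ∈ polyhedron a b ↔ ∀ k, 0 ≤ slack a b k z := by
  simp [polyhedron, slack]

theorem slack_add {a : Fin (d + d) → E d} {b : Fin (d + d) → ℝ} (k : Fin (d + d)) (z u : E d) :
    slack a b k (z + u) = slack a b k z - inner ℝ (a k) u := by
  rw [slack, slack, inner_add_right]; ring

/-- Points with proportional slacks have the same tight constraints. -/
theorem mem_and_act_of_slack {a : Fin (d + d) → E d} {b : Fin (d + d) → ℝ} {N : Fin d → E d}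
    {z w : E d} (h1 : ∀ j, ∃ p > 0, slack a b (Fin.castAdd d j) z = p * w j)
    (h2 : ∀ i, ∃ p > 0, slack a b (Fin.natAdd d i) z = p * (1 - inner ℝ (N i) w)) :
    (z ∈ polyhedron a b ↔ w ∈ stdPoly N) ∧ act a b z = stdAct N w := by
  constructor
  · rw [mem_polyhedron_iff_slack, mem_stdPoly]
    constructor
    · intro h
      refine ⟨fun j => ?_, fun i => ?_⟩
      · obtain ⟨p, hp, e⟩ := h1 j
        have := h (Fin.castAdd d j)
        rw [e] at this
        exact nonneg_of_mul_nonneg_right this hp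
      · obtain ⟨p, hp, e⟩ := h2 i
        have := h (Fin.natAdd d i)
        rw [e] at this
        exact sub_nonneg.1 (nonneg_of_mul_nonneg_right this hp)
    · rintro ⟨h3, h4⟩ k
      induction k using Fin.addCases with
      | left j =>
        obtain ⟨p, hp, e⟩ := h1 j
        rw [e]
        exact mul_nonneg hp.le (h3 j)
      | right i =>
        obtain ⟨p, hp, e⟩ := h2 i
        rw [e]
        exact mul_nonneg hp.le (sub_nonneg.2 (h4 i))
  · refine set_ext_add (fun j => ?_) fun i => ?_
    · obtain ⟨p, hp, e⟩ := h1 j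
      rw [mem_act_iff_slack, castAdd_mem_stdAct, e, mul_eq_zero]
      simp [hp.ne']
    · obtain ⟨p, hp, e⟩ := h2 i
      rw [mem_act_iff_slack, natAdd_mem_stdAct, e, mul_eq_zero, sub_eq_zero, eq_comm (a := (1 : ℝ))]
      simp [hp.ne']

namespace Describes

variable {a : Fin (d + d) → E d} {b : Fin (d + d) → ℝ} {D : Figure d}

theorem slack_x (h : Describes a b D) (j : Fin d) : slack a b (Fin.castAdd d j) D.x = 0 :=
  mem_act_iff_slack.1 (h.act_x ▸ ⟨j, rfl⟩)

theorem slack_y (h : Describes a b D) (i : Fin d) : slack a b (Fin.natAdd d i) D.y = 0 :=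
  mem_act_iff_slack.1 (h.act_y ▸ ⟨i, rfl⟩)

theorem slack_x_pos (h : Describes a b D) (i : Fin d) : 0 < slack a b (Fin.natAdd d i) D.x :=
  sub_pos.2 (lt_of_notMem_act (h.poly ▸ D.x_mem) (by rw [h.act_x]; exact natAdd_notMem_range i))

theorem slack_y_pos (h : Describes a b D) (j : Fin d) : 0 < slack a b (Fin.castAdd d j) D.y :=
  sub_pos.2 (lt_of_notMem_act (h.poly ▸ D.y_mem) (by rw [h.act_y]; exact castAdd_notMem_range j))

theorem inj_x (h : Describes a b D) (u : E d)
    (hu : ∀ j, inner ℝ (a (Fin.castAdd d j)) u = 0) : u = 0 := by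
  have hx := D.x_vertex
  rw [h.poly, mem_extremePoints_iff, h.act_x] at hx
  refine hx.2 u ?_
  rintro _ ⟨j, rfl⟩
  exact hu j

theorem inj_y (h : Describes a b D) (u : E d)
    (hu : ∀ i, inner ℝ (a (Fin.natAdd d i)) u = 0) : u = 0 := by
  have hy := D.y_vertex
  rw [h.poly, mem_extremePoints_iff, h.act_y] at hy
  refine hy.2 u ?_
  rintro _ ⟨i, rfl⟩
  exact hu i

theorem linearIndependent (h : Describes a b D) :
    LinearIndependent ℝ fun j => a (Fin.castAdd d j) := by
  have := linearIndepOn_of_forall_inner (a := fun j => a (Fin.castAdd d j)) (J := Set.univ)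
    (fun u hu => h.inj_x u fun i => hu i trivial) (by simp [Set.ncard_univ])
  rwa [linearIndepOn_univ_iff] at this

theorem exists_slackMatrix (h : Describes a b D) : ∃ M, SlackMatrix a b D M := by
  have hspan : ∀ v : E d, ∃ c : Fin d → ℝ, ∑ j, c j • a (Fin.castAdd d j) = v := by
    intro v
    have h1 := h.linearIndependent.span_eq_top_of_card_eq_finrank' (by simp)
    have h2 : v ∈ Submodule.span ℝ (Set.range fun j => a (Fin.castAdd d j)) := h1 ▸ trivial
    exact (Submodule.mem_span_range_iff_exists_fun ℝ).1 h2
  choose c hc using fun i => hspan (a (Fin.natAdd d i))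
  -- The normals at `x` form a basis. The coefficients of the other normals in it are rescaled by
  -- the slacks that the normalization divides out.
  refine ⟨fun i j => -c i j * slack a b (Fin.castAdd d j) D.y / slack a b (Fin.natAdd d i) D.x,
    fun i z => ?_⟩
  have hxi := (h.slack_x_pos i).ne'
  have h1 : ∀ j, inner ℝ (a (Fin.castAdd d j)) (z - D.x) = -slack a b (Fin.castAdd d j) z := by
    intro j
    have := slack_add (a := a) (b := b) (Fin.castAdd d j) D.x (z - D.x)
    rw [add_sub_cancel, h.slack_x] at this
    linarith
  have h2 := slack_add (a := a) (b := b) (Fin.natAdd d i) D.x (z - D.x)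
  rw [add_sub_cancel, ← hc i, sum_inner] at h2
  simp only [real_inner_smul_left, h1] at h2
  rw [h2, mul_sub, mul_one, Finset.mul_sum]
  congr 1
  refine Finset.sum_congr rfl fun j _ => ?_
  have hyj := (h.slack_y_pos j).ne'
  field_simp

theorem sum_eq_one (h : Describes a b D) {M : Fin d → Fin d → ℝ} (hM : SlackMatrix a b D M)
    (i : Fin d) : ∑ j, M i j = 1 := by
  have h1 := hM i D.y
  rw [h.slack_y, eq_comm, mul_eq_zero] at h1
  have h2 := h1.resolve_left (h.slack_x_pos i).ne'
  have h3 : ∀ j, M i j * (slack a b (Fin.castAdd d j) D.y / slack a b (Fin.castAdd d j) D.y) =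
      M i j := fun j => by rw [div_self (h.slack_y_pos j).ne', mul_one]
  simp only [h3] at h2
  linarith

/-- The first slacks can be prescribed. -/
theorem exists_slack_eq (h : Describes a b D) (t : Fin d → ℝ) :
    ∃ z, ∀ j, slack a b (Fin.castAdd d j) z / slack a b (Fin.castAdd d j) D.y = t j := by
  obtain ⟨u, hu⟩ := exists_inner_eq_of_linearIndependent h.linearIndependent
    fun j => b (Fin.castAdd d j) - t j * slack a b (Fin.castAdd d j) D.y
  refine ⟨u, fun j => ?_⟩
  rw [div_eq_iff (h.slack_y_pos j).ne', slack, hu]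
  ring

/-- A kernel vector gives a point with the same last slacks as `x`; since the normals at `y` span,
this point is `x`. -/
theorem slackMatrix_inj (h : Describes a b D) {M : Fin d → Fin d → ℝ} (hM : SlackMatrix a b D M)
    {u : Fin d → ℝ} (hu : ∀ i, ∑ j, M i j * u j = 0) : u = 0 := by
  obtain ⟨z, hz⟩ := h.exists_slack_eq u
  have h1 : z - D.x = 0 := by
    refine h.inj_y _ fun i => ?_
    have h2 := hM i z
    simp only [hz, hu, sub_zero, mul_one] at h2
    have h3 := slack_add (a := a) (b := b) (Fin.natAdd d i) D.x (z - D.x)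
    rw [add_sub_cancel] at h3
    linarith
  ext j
  rw [← hz j, sub_eq_zero.1 h1, h.slack_x, zero_div]
  rfl

/-- By boundedness, there is no non-zero non-negative vector on which the slack matrix is
non-positive. -/
theorem eq_zero_of_nonneg (h : Describes a b D) {M : Fin d → Fin d → ℝ}
    (hM : SlackMatrix a b D M) {w : Fin d → ℝ} (hw : ∀ j, 0 ≤ w j)
    (hMw : ∀ i, ∑ j, M i j * w j ≤ 0) : w = 0 := by
  obtain ⟨z, hz⟩ := h.exists_slack_eq w
  have hline : ∀ t : ℝ, ∀ j, slack a b (Fin.castAdd d j) (D.x + t • (z - D.x)) =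
      t * slack a b (Fin.castAdd d j) z := fun t j => by
    have h1 := slack_add (a := a) (b := b) (Fin.castAdd d j) D.x (z - D.x)
    rw [add_sub_cancel, h.slack_x] at h1
    rw [slack_add, real_inner_smul_right, h.slack_x, h1]
    ring
  -- Were `w` non-zero, the polytope would contain a whole ray from `x`.
  have hmem : ∀ t : ℝ, 0 ≤ t → D.x + t • (z - D.x) ∈ polyhedron a b := by
    intro t ht
    rw [mem_polyhedron_iff_slack]
    intro k
    induction k using Fin.addCases with
    | left j =>
      rw [hline, ← div_mul_cancel₀ (slack a b (Fin.castAdd d j) z) (h.slack_y_pos j).ne', hz]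
      exact mul_nonneg ht (mul_nonneg (hw j) (h.slack_y_pos j).le)
    | right i =>
      rw [hM i]
      refine mul_nonneg (h.slack_x_pos i).le ?_
      simp only [hline, mul_div_assoc, hz]
      have : ∑ j, M i j * (t * w j) = t * ∑ j, M i j * w j := by
        rw [Finset.mul_sum]
        exact Finset.sum_congr rfl fun j _ => by ring
      rw [this]
      have := mul_nonneg ht (neg_nonneg.2 (hMw i))
      linarith
  have hb : Bornology.IsBounded (polyhedron a b) := h.poly ▸ D.simple.1.2.1
  have hzx : z - D.x = 0 := by
    by_contra hne
    obtain ⟨R, hR⟩ := hb.exists_norm_le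
    have hpos : 0 < ‖z - D.x‖ := norm_pos_iff.2 hne
    have hR0 : 0 ≤ R := (norm_nonneg _).trans (hR _ (hmem 0 le_rfl))
    have hx := hR D.x (h.poly ▸ D.x_mem)
    have h1 := hR _ (hmem ((2 * R + 1) / ‖z - D.x‖) (by positivity))
    have h2 : ‖((2 * R + 1) / ‖z - D.x‖) • (z - D.x)‖ = 2 * R + 1 := by
      rw [norm_smul, Real.norm_of_nonneg (by positivity), div_mul_cancel₀ _ hpos.ne']
    have h3 := norm_sub_le (D.x + ((2 * R + 1) / ‖z - D.x‖) • (z - D.x)) D.x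
    rw [add_sub_cancel_left, h2] at h3
    linarith
  ext j
  rw [← hz j, sub_eq_zero.1 hzx, h.slack_x, zero_div]
  rfl

/-- A projective transformation carries the figure to a standard system. -/
theorem activeSets_eq (h : Describes a b D) {M : Fin d → Fin d → ℝ} (hM : SlackMatrix a b D M)
    {e : Fin d → ℝ} (he : ∀ j, 0 ≤ e j) {N : Fin d → E d} (hN : ∀ i j, N i j = M i j + e j) :
    activeSets a b = activeSets (stdNormal N) (stdOffset d) := by
  have hinner : ∀ i (w : E d), inner ℝ (N i) w = ∑ j, M i j * w j + ∑ j, e j * w j := fun i w => by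
    rw [inner_eq_sum, ← Finset.sum_add_distrib]
    exact Finset.sum_congr rfl fun j _ => by rw [hN]; ring
  apply Set.Subset.antisymm
  · rintro _ ⟨z, hz, rfl⟩
    -- In normalized slacks the projective map is `t ↦ t / (1 + ⟨e, t⟩)`, with inverse `w ↦ w / (1 -
    -- ⟨e, w⟩)`.
    let t : Fin d → ℝ := fun j => slack a b (Fin.castAdd d j) z / slack a b (Fin.castAdd d j) D.y
    have ht : ∀ j, 0 ≤ t j := fun j =>
      div_nonneg (mem_polyhedron_iff_slack.1 hz _) (h.slack_y_pos j).le
    have hσ : 0 < 1 + ∑ j, e j * t j :=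
      add_pos_of_pos_of_nonneg one_pos (Finset.sum_nonneg fun j _ => mul_nonneg (he j) (ht j))
    generalize hσ' : 1 + ∑ j, e j * t j = σ at hσ
    have hsum : ∀ f : Fin d → ℝ, ∑ j, f j * (t j / σ) = (∑ j, f j * t j) / σ := fun f => by
      rw [Finset.sum_div]
      exact Finset.sum_congr rfl fun j _ => by ring
    have key := mem_and_act_of_slack (a := a) (b := b) (N := N) (z := z)
      (w := WithLp.toLp 2 fun j => t j / σ)
      (fun j => ⟨slack a b (Fin.castAdd d j) D.y * σ, mul_pos (h.slack_y_pos j) hσ, ?_⟩)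
      (fun i => ⟨slack a b (Fin.natAdd d i) D.x * σ, mul_pos (h.slack_x_pos i) hσ, ?_⟩)
    · exact ⟨_, key.1.1 hz, key.2.symm⟩
    · have := (h.slack_y_pos j).ne'
      simp only [t]
      field_simp
    · rw [hM i z, hinner]
      simp only [hsum]
      change _ * (1 - ∑ j, M i j * t j) = _
      field_simp
      linear_combination slack a b (Fin.natAdd d i) D.x * hσ'
  · rintro _ ⟨w, hw, rfl⟩
    have hw' := mem_stdPoly.1 hw
    -- Otherwise `M w ≤ 1 - ⟨e, w⟩ ≤ 0` in every row, so `w = 0` by boundedness, contradicting `⟨e,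
    -- w⟩ ≥ 1`.
    have hσ : ∑ j, e j * w j < 1 := by
      by_contra hge
      rw [not_lt] at hge
      have h0 := h.eq_zero_of_nonneg hM hw'.1 fun i => by
        have := hw'.2 i
        rw [hinner] at this
        linarith
      have h1 : ∑ j, e j * w j = 0 := Finset.sum_eq_zero fun j _ => by
        have : w j = 0 := congrFun h0 j
        rw [this, mul_zero]
      linarith
    generalize hσ' : 1 - ∑ j, e j * w j = σ
    have hσ0 : 0 < σ := by linarith
    obtain ⟨z, hz⟩ := h.exists_slack_eq fun j => w j / σ
    have hsum : ∀ f : Fin d → ℝ, ∑ j, f j * (w j / σ) = (∑ j, f j * w j) / σ := fun f => by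
      rw [Finset.sum_div]
      exact Finset.sum_congr rfl fun j _ => by ring
    have key := mem_and_act_of_slack (a := a) (b := b) (N := N) (z := z) (w := w)
      (fun j => ⟨slack a b (Fin.castAdd d j) D.y / σ, div_pos (h.slack_y_pos j) hσ0, ?_⟩)
      (fun i => ⟨slack a b (Fin.natAdd d i) D.x / σ, div_pos (h.slack_x_pos i) hσ0, ?_⟩)
    · exact ⟨z, key.1.2 hw, key.2⟩
    · have h1 := hz j
      have := (h.slack_y_pos j).ne'
      field_simp at h1 ⊢
      linarith
    · rw [hM i z, hinner]
      simp only [hz, hsum]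
      field_simp
      linear_combination (-slack a b (Fin.natAdd d i) D.x) * hσ'

theorem sameType_stdFigure (h : Describes a b D) {M : Fin d → Fin d → ℝ}
    (hM : SlackMatrix a b D M) {e : Fin d → ℝ} (he : ∀ j, 0 ≤ e j) {N : Fin d → E d}
    (hN : ∀ i j, N i j = M i j + e j) (hg : Good N) :
    ∃ hn : Nondegenerate (stdNormal N) (stdOffset d), SameType D (stdFigure N hg hn) := by
  have hact := h.activeSets_eq hM he hN
  have hn : Nondegenerate (stdNormal N) (stdOffset d) := by
    rw [nondegenerate_iff_activeSets, ← hact, ← nondegenerate_iff_activeSets]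
    exact h.nondegenerate
  refine ⟨hn, sameType_of_activeSets_eq h.poly rfl hact ?_ ?_⟩
  · exact h.act_x.trans (stdAct_x hg hn).symm
  · exact h.act_y.trans (stdAct_y hg hn).symm

end Describes

/-! ### Relabelling the facets at `x` -/

/-- The permutation of the constraints that permutes only the first `d`. -/
def permFirst (σ : Equiv.Perm (Fin d)) : Equiv.Perm (Fin (d + d)) :=
  finSumFinEquiv.symm.trans ((σ.sumCongr (Equiv.refl (Fin d))).trans finSumFinEquiv)

theorem permFirst_castAdd (σ : Equiv.Perm (Fin d)) (j : Fin d) :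
    permFirst σ (Fin.castAdd d j) = Fin.castAdd d (σ j) := by simp [permFirst]

theorem permFirst_natAdd (σ : Equiv.Perm (Fin d)) (i : Fin d) :
    permFirst σ (Fin.natAdd d i) = Fin.natAdd d i := by
  simp only [permFirst, Equiv.trans_apply, finSumFinEquiv_symm_apply_natAdd, Equiv.sumCongr_apply,
    Sum.map_inr, Equiv.refl_apply, finSumFinEquiv_apply_right]

theorem Describes.perm {a : Fin (d + d) → E d} {b : Fin (d + d) → ℝ} {D : Figure d}
    (h : Describes a b D) (σ : Equiv.Perm (Fin d)) :
    Describes (a ∘ permFirst σ) (b ∘ permFirst σ) D := by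
  have hpoly : polyhedron (a ∘ permFirst σ) (b ∘ permFirst σ) = polyhedron a b := by
    ext z
    exact ⟨fun h j => by simpa using h ((permFirst σ).symm j), fun h j => h _⟩
  have hact : ∀ z, act (a ∘ permFirst σ) (b ∘ permFirst σ) z = permFirst σ ⁻¹' act a b z :=
    fun z => rfl
  refine ⟨h.poly.trans hpoly.symm, fun z hz => ?_, ?_, ?_⟩
  · rw [hact, Set.ncard_preimage_of_injective_subset_range (permFirst σ).injective (by simp)]
    exact h.nondegenerate z (hpoly ▸ hz)
  · rw [hact, h.act_x]
    refine set_ext_add (fun j => ?_) fun i => ?_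
    · rw [Set.mem_preimage, permFirst_castAdd]
      simp only [Set.mem_range_self]
    · rw [Set.mem_preimage, permFirst_natAdd]
  · rw [hact, h.act_y]
    refine set_ext_add (fun j => ?_) fun i => ?_
    · rw [Set.mem_preimage, permFirst_castAdd]
      simp only [castAdd_notMem_range]
    · rw [Set.mem_preimage, permFirst_natAdd]

theorem SlackMatrix.perm {a : Fin (d + d) → E d} {b : Fin (d + d) → ℝ} {D : Figure d}
    {M : Fin d → Fin d → ℝ} (hM : SlackMatrix a b D M) (σ : Equiv.Perm (Fin d)) :
    SlackMatrix (a ∘ permFirst σ) (b ∘ permFirst σ) D fun i j => M i (σ j) := by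
  intro i z
  have h1 : ∀ k z, slack (a ∘ permFirst σ) (b ∘ permFirst σ) k z = slack a b (permFirst σ k) z :=
    fun _ _ => rfl
  simp only [h1, permFirst_castAdd, permFirst_natAdd]
  rw [hM i z]
  congr 2
  exact (Equiv.sum_comp σ fun j => M i j *
    (slack a b (Fin.castAdd d j) z / slack a b (Fin.castAdd d j) D.y)).symm

/-! ### Normal forms -/

section NormalForm

variable {m : ℕ}

/-- The figure has the type of all standard systems with differences `A` and large first row. -/
def HasDifferences (D : Figure (m + 1)) (A : Matrix (Fin m) (Fin m) ℝ) : Prop :=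
  A.det ≠ 0 ∧ ∃ C : ℝ, ∀ c, (∀ j, C ≤ c j) → ∀ hg : Good (rowsOf A c),
    ∃ hn : Nondegenerate (stdNormal (rowsOf A c)) (stdOffset (m + 1)),
      SameType D (stdFigure (rowsOf A c) hg hn)

/-- A kernel vector of the differences, extended by 0, is mapped by `M` to a constant vector `κ`. As
the rows of `M` sum to 1, subtracting `κ` gives a kernel vector of `M`, which must vanish; its first
coordinate shows `κ = 0`. Making `c` larger than the first row of `M` makes the common shift `c - M
0` non-negative. -/
theorem hasDifferences_of_slackMatrix {D : Figure (m + 1)}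
    {a : Fin (m + 1 + (m + 1)) → E (m + 1)} {b : Fin (m + 1 + (m + 1)) → ℝ}
    (h : Describes a b D) {M : Fin (m + 1) → Fin (m + 1) → ℝ} (hM : SlackMatrix a b D M) :
    HasDifferences D (Matrix.of fun i j : Fin m => M i.succ j.succ - M 0 j.succ) := by
  have hsum := h.sum_eq_one hM
  refine ⟨fun hdet => ?_, ?_⟩
  · obtain ⟨v, hv, hAv⟩ := Matrix.exists_mulVec_eq_zero_iff.2 hdet
    let u : Fin (m + 1) → ℝ := Fin.cons 0 v
    let κ : ℝ := ∑ j, M 0 j * u j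
    have hu : ∀ i, ∑ j, M i j * u j = κ := by
      intro i
      refine Fin.cases rfl (fun i => ?_) i
      have := congrFun hAv i
      simp only [Matrix.mulVec, dotProduct, Matrix.of_apply, sub_mul, Finset.sum_sub_distrib,
        Pi.zero_apply] at this
      simp only [κ, Fin.sum_univ_succ, u, Fin.cons_zero, Fin.cons_succ]
      linarith
    have h0 : (fun j => u j - κ) = 0 := h.slackMatrix_inj hM fun i => by
      simp only [mul_sub, Finset.sum_sub_distrib, ← Finset.sum_mul, hu, hsum]
      ring
    have hκ : κ = 0 := by
      have := congrFun h0 0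
      simpa [u] using this
    refine hv (funext fun j => ?_)
    have := congrFun h0 j.succ
    simpa [u, hκ] using this
  · obtain ⟨C, hC⟩ := exists_forall_lt fun j => M 0 j
    refine ⟨C, fun c hc hg => h.sameType_stdFigure hM (e := fun j => c j - M 0 j)
      (fun j => sub_nonneg.2 ((hC j).le.trans (hc j))) (fun i j => ?_) hg⟩
    refine Fin.cases ?_ (fun i => ?_) i
    · rw [rowsOf_zero]; ring
    · refine Fin.cases ?_ (fun j => ?_) j
      · rw [rowsOf_succ_zero]
        have h1 := hsum 0
        have h2 := hsum i.succ
        rw [Fin.sum_univ_succ] at h1 h2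
        simp only [Matrix.of_apply, Finset.sum_sub_distrib]
        linarith
      · rw [rowsOf_succ_succ, Matrix.of_apply]; ring

theorem exists_hasDifferences (hm : 2 ≤ m) (D : Figure (m + 1)) :
    (∃ A, HasDifferences D A ∧ 0 < A.det) := by
  obtain ⟨a, b, hP, -, hn, hx, hy⟩ := D.exists_system
  have h : Describes a b D := ⟨hP, hn, hx, hy⟩
  obtain ⟨M, hM⟩ := h.exists_slackMatrix
  have h1 := hasDifferences_of_slackMatrix h hM
  rcases h1.1.lt_or_gt with hneg | hpos
  · let p : Fin m := ⟨0, by omega⟩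
    let q : Fin m := ⟨1, by omega⟩
    have hpq : p ≠ q := fun h => by simpa [p, q] using congrArg Fin.val h
    have h2 := hasDifferences_of_slackMatrix (h.perm (Equiv.swap p.succ q.succ))
      (hM.perm (Equiv.swap p.succ q.succ))
    refine ⟨_, h2, ?_⟩
    have hsucc : ∀ j : Fin m, Equiv.swap p.succ q.succ j.succ = (Equiv.swap p q j).succ :=
      fun j => ((Fin.succ_injective m).map_swap p q j).symm
    have h3 : (Matrix.of fun i j : Fin m => M i.succ (Equiv.swap p.succ q.succ j.succ) -
        M 0 (Equiv.swap p.succ q.succ j.succ)) =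
        (Matrix.of fun i j : Fin m => M i.succ j.succ - M 0 j.succ).submatrix id
          (Equiv.swap p q) := by
      ext i j
      simp [hsucc]
    rw [h3, Matrix.det_permute', Equiv.Perm.sign_swap hpq]
    simpa using hneg
  · exact ⟨_, h1, hpos⟩

theorem exists_positive_rowsOf (A : Matrix (Fin m) (Fin m) ℝ) (C : ℝ) :
    ∃ c, (∀ j, C ≤ c j) ∧ ∀ i j, 0 < rowsOf A c i j := by
  obtain ⟨K, hK⟩ := exists_forall_lt fun p : Fin (m + 1) × Fin (m + 1) => -rowsOf A 0 p.1 p.2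
  refine ⟨fun _ => max K C, fun _ => le_max_right _ _, fun i j => ?_⟩
  have h1 := hK (i, j)
  have h2 := le_max_left K C
  simp only at h1
  have h3 : rowsOf A (fun _ => max K C) i j = rowsOf A 0 i j + max K C := by
    refine Fin.cases ?_ (fun i => ?_) i
    · simp [rowsOf_zero]
    · refine Fin.cases ?_ (fun j => ?_) j
      · simp [rowsOf_succ_zero]; ring
      · simp [rowsOf_succ_succ]; ring
  linarith

theorem exists_steps (hm : 2 ≤ m) (D₁ D₂ : Figure (m + 1)) :
    ∃ D₁' D₂' : Figure (m + 1), SameType D₁ D₁' ∧ SameType D₂ D₂' ∧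
      Relation.ReflTransGen Step D₁' D₂' := by
  obtain ⟨A, ⟨hA, C, hC⟩, hApos⟩ := exists_hasDifferences hm D₁
  obtain ⟨B, ⟨hB, C', hC'⟩, hBpos⟩ := exists_hasDifferences hm D₂
  have : Nonempty (Fin m) := ⟨⟨0, by omega⟩⟩
  have hlink := (linked_of_det_mul_pos (mul_pos hApos hBpos)).climbs hA
  obtain ⟨c, hc, hpos⟩ := exists_positive_rowsOf A C
  have hg := good_rowsOf hA hpos
  obtain ⟨hn, hD₁⟩ := hC c hc hg
  obtain ⟨c', hc', hpos', hreach⟩ := hlink c hpos C'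
  have hg' := good_rowsOf hB hpos'
  obtain ⟨hn', hD₂⟩ := hC' c' hc' hg'
  -- The chain ends only near `rowsOf B c'`, so the target neighbourhood is taken inside the good
  -- systems of the same combinatorial type.
  obtain ⟨V, hV, hVr⟩ := hreach _ (Filter.inter_mem (isOpen_good.mem_nhds hg')
    (eventually_activeSets_eq hg' hn'))
  obtain ⟨N, ⟨hgN, hact⟩, hnN, hchain⟩ := hVr _ (mem_of_mem_nhds hV) hn
  refine ⟨_, stdFigure N hgN hnN, hD₁, (sameType_equivalence _).trans hD₂ ?_,
    hchain hg hn hgN hnN⟩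
  refine sameType_of_activeSets_eq (a := stdNormal (rowsOf B c')) (b := stdOffset _)
    (a' := stdNormal N) (b' := stdOffset _) rfl rfl (Eq.symm hact) ?_ ?_
  · exact (stdAct_x hg' hn').trans (stdAct_x hgN hnN).symm
  · exact (stdAct_y hg' hn').trans (stdAct_y hgN hnN).symm

end NormalForm

/-! ### From chains of figures to paths in the moduli graph -/

theorem Figure.type_eq_iff {D D' : Figure d} : D.type = D'.type ↔ SameType D D' :=
  Quotient.eq (r := Setoid.mk (SameType (d := d)) (sameType_equivalence d))

theorem moduliGraph_path_of_steps {D D' : Figure d} (h : Relation.ReflTransGen Step D D') :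
    Relation.ReflTransGen (moduliGraph d).Adj D.type D'.type := by
  induction h with
  | refl => exact .refl
  | tail _ h ih =>
    rcases h with h | ⟨-, h⟩
    · exact ih.tail ⟨_, _, rfl, rfl, h⟩
    · rwa [← Figure.type_eq_iff.2 h]

end Dantzig

theorem mainTheorem3 (d : ℕ) (hd : 3 ≤ d) :
    Dantzig.StronglyConnected (Dantzig.moduliGraph d) ∧
    ∀ D₁ D₂ : Dantzig.Figure d, ∃ D₁' D₂' : Dantzig.Figure d,
      Dantzig.SameType D₁ D₁' ∧ Dantzig.SameType D₂ D₂' ∧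
      Relation.ReflTransGen
        (fun D D' => Dantzig.FundamentalDeformation D D' ∨ Dantzig.SimpleMove D D') D₁' D₂' := by
  obtain ⟨m, rfl⟩ : ∃ m, d = m + 1 := ⟨d - 1, by omega⟩
  have hm : 2 ≤ m := by omega
  refine ⟨fun u v => ?_, fun D₁ D₂ => ?_⟩
  · induction u using Quotient.ind with
    | _ D₁ =>
    induction v using Quotient.ind with
    | _ D₂ =>
    obtain ⟨D₁', D₂', h1, h2, h3⟩ := Dantzig.exists_steps hm D₁ D₂
    have h4 := Dantzig.moduliGraph_path_of_steps h3
    rwa [← Dantzig.Figure.type_eq_iff.2 h1, ← Dantzig.Figure.type_eq_iff.2 h2] at h4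
  · obtain ⟨D₁', D₂', h1, h2, h3⟩ := Dantzig.exists_steps hm D₁ D₂
    exact ⟨D₁', D₂', h1, h2, Relation.ReflTransGen.mono
      (fun _ _ h => h.imp_right fun h => h.1) _ _ h3⟩
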